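/- **Setup.** Let $\mathbb O=\mathbb H\oplus\mathbb H$ be the octonions with product $(a,b)(c,d)=(ac-\overline d\,b,\;da+b\overline c)$, standard orthonormal basis $e_0=1,e_1,\dots,e_7$ and Euclidean inner product. Let $\circ$ be a normalized orthogonal multiplication on $\mathbb O$: a bilinear operation with $|x\circ y|=|x||y|$ and $e_0\circ x=x\circ e_0=x$ for all $x,y\in\mathbb O$. On $\mathbb R^{32}=\mathbb O^4$ put $$P_{-1}(A,X,Y,B)=(A,-X,Y,-B),\qquad P_a(A,X,Y,B)=(-Xe_a,\,-A\overline e_a,\,-B\circ\overline e_a,\,-Y\circ e_a)\quad(0\le a\le 7),$$ and $F(z)=-|z|^4+2\sum_{i=-1}^{7}\langle P_iz,z\rangle^2$. The isoparametric hypersurfaces of Ferus, Karcher and Münzner are the level sets $F=c$, $-1<c<1$, in the unit sphere $S^{31}$; their focal submanifolds are $M_\pm=\{z\in S^{31}:F(z)=\pm1\}$, so that $M_-$ is the set of $z\in S^{31}$ with $\langle P_iz,z\rangle=0$ for all $i$. **Mirror points.** Let $x\in M_+$ be a point of Condition A (the shape operators of $M_+\subset S^{31}$ at $x$ in all normal directions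 have the same kernel) and $n_0$ a unit normal vector of $M_+$ at $x$. The mirror points of $x$ are $x^\#=n_0\in M_+$, with normal vector $x$, and $x^*=(x+n_0)/\sqrt2\in M_-$, with normal vector $n_0^*=(x-n_0)/\sqrt2$. Let $V_+,V_-,V_0$ be the eigenspaces for $1,-1,0$ of the shape operator of $M_+$ at $x$ in the direction $n_0$. We say that *the multiplication at $x^*$ is $\circ'$* if, for some such $x,n_0$, there are linear isometries identifying $V_+\cong\mathbb O$, $V_-\cong\mathbb O$, $V_0\cong\mathrm{Im}\,\mathbb O$, and the orthogonal complement $N$ of $n_0$ in the normal space of $M_+$ at $x$ with $\mathrm{Im}\,\mathbb O$, such that, for $u\in V_+$, $v\in V_-$, $a\in\mathrm{Im}\,\mathbb O$, with $II$ denoting second fundamental forms in $S^{31}$ and $II(U,U)$ abbreviating the values of the quadratic forms: 1. at $x$ the tangent space is $V_+\oplus V_-\oplus V_0$, and for $U=u+v+y$, $y\in V_0$, the component of $II(U,U)$ along the element of $N$ corresponding to $a$ is $2\langle av,u\rangle$; 2. at $x^\#$ the eigenspaces for $1,-1,0$ of the shape operator in the direction $x$ are $V_+,V_-,N$ and span the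 tangent space, the orthogonal complement of $x$ in the normal space is $V_0$, and for $U=u+v+y$, $y\in N$, the component of $II(U,U)$ along the element of $V_0$ corresponding to $a$ is $2\langle a\circ' v,u\rangle$; 3. at $x^*$ the eigenspaces for $1,-1,0$ of the shape operator of $M_-$ in the direction $n_0^*$ are $N,V_0,V_-$ and span the tangent space, the normal space is $\mathbb Rn_0^*\oplus V_+$, and for $W=X\oplus Y\oplus Z\in N\oplus V_0\oplus V_-$ $$II(W,W)=(|X|^2-|Y|^2)\,n_0^*\;\oplus\;-\sqrt2\,(XZ+Y\circ' Z).$$ **Proposition 5.1.** For every such $\circ$ there is a mirror point $x^*\in M_-$ at which the multiplication $\circ'$ is either $a\circ' b=ab$ for all $a,b\in\mathbb O$, or $a\circ' b=ba$ for all $a,b\in\mathbb O$. Moreover, there is a linear isometry $\Phi$ of $\mathbb R^{32}$ that carries $x^*$ to $(0,e_0,-e_0,0)/\sqrt2$ and the Clifford system $P_{-1},P_0,\dots,P_7$ of $\circ$ to the one defined by the same formulas with $\circ'$ in place of $\circ$, i.e. $\Phi P_i\Phi^{-1}=P_i'$ for $-1\le i\le 7$. -/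

import Mathlib

open scoped Quaternion ContDiff Topology InnerProductSpace

noncomputable section

namespace Isoparametric

/-! ### Octonions -/

/-- The octonions `𝕆 = ℍ ⊕ ℍ`, as a Euclidean space of dimension eight. -/
abbrev Oct : Type := WithLp 2 (ℍ[ℝ] × ℍ[ℝ])

/-- The octonion `(a, b)`. -/
def Oct.mk (a b : ℍ[ℝ]) : Oct := WithLp.toLp 2 (a, b)

/-- Octonion multiplication `(a, b)(c, d) = (a c - d̄ b, d a + b c̄)`, as a bilinear map. -/
def octMul : Oct →ₗ[ℝ] Oct →ₗ[ℝ] Oct :=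
  LinearMap.mk₂ ℝ
    (fun x y => Oct.mk (x.fst * y.fst - star y.snd * x.snd) (y.snd * x.fst + x.snd * star y.fst))
    (fun x x' y => by
      simp only [Oct.mk, ← WithLp.toLp_add, Prod.mk_add_mk, WithLp.add_fst, WithLp.add_snd]
      congr 2 <;> noncomm_ring)
    (fun c x y => by
      simp only [Oct.mk, ← WithLp.toLp_smul, Prod.smul_mk, WithLp.smul_fst, WithLp.smul_snd,
        smul_mul_assoc, mul_smul_comm, smul_sub, smul_add])
    (fun x y y' => by
      simp only [Oct.mk, ← WithLp.toLp_add, Prod.mk_add_mk, WithLp.add_fst, WithLp.add_snd,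
        star_add]
      congr 2 <;> noncomm_ring)
    (fun c x y => by
      simp only [Oct.mk, ← WithLp.toLp_smul, Prod.smul_mk, WithLp.smul_fst, WithLp.smul_snd,
        Quaternion.star_smul, smul_mul_assoc, mul_smul_comm, smul_sub, smul_add])

/-- Octonion conjugation `(a, b) ↦ (ā, -b)`. -/
def octConj (x : Oct) : Oct := Oct.mk (star x.fst) (-x.snd)

/-- The standard basis `e₀, …, e₇ = 1, i, j, k, ε, iε, jε, kε` with `ε = (0, 1)`. -/
def octBasis : Fin 8 → Oct :=
  ![Oct.mk 1 0, Oct.mk ⟨0, 1, 0, 0⟩ 0, Oct.mk ⟨0, 0, 1, 0⟩ 0, Oct.mk ⟨0, 0, 0, 1⟩ 0,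
    Oct.mk 0 1, Oct.mk 0 ⟨0, 1, 0, 0⟩, Oct.mk 0 ⟨0, 0, 1, 0⟩, Oct.mk 0 ⟨0, 0, 0, 1⟩]

/-- The unit octonion `e₀`. -/
def octOne : Oct := octBasis 0

/-- The purely imaginary octonions. -/
def ImOct : Submodule ℝ Oct := (Submodule.span ℝ {octOne})ᗮ

/-- A normalized orthogonal multiplication on `𝕆`: a bilinear operation with
`|x ∘ y| = |x| |y|` for which `e₀` is a two-sided unit. -/
structure IsNormalizedOrthogonalMultiplication (op : Oct →ₗ[ℝ] Oct →ₗ[ℝ] Oct) : Prop where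
  norm_op : ∀ x y, ‖op x y‖ = ‖x‖ * ‖y‖
  one_op : ∀ x, op octOne x = x
  op_one : ∀ x, op x octOne = x

/-! ### Submanifolds of the unit sphere -/

section Geometry

variable {E : Type*} [NormedAddCommGroup E] [InnerProductSpace ℝ E]

/-- `γ` is (the germ at `0` of) a smooth curve in `M` through `x`. -/
structure IsCurveIn (M : Set E) (x : E) (γ : ℝ → E) : Prop where
  smooth : ContDiffAt ℝ ∞ γ 0
  mem : ∀ᶠ t in 𝓝 (0 : ℝ), γ t ∈ M
  base : γ 0 = x

/-- The tangent space of `M` at `x`, spanned by the velocities of curves in `M`. -/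
def tangentSpace (M : Set E) (x : E) : Submodule ℝ E :=
  Submodule.span ℝ {v | ∃ γ : ℝ → E, IsCurveIn M x γ ∧ deriv γ 0 = v}

/-- The normal space at `x` of `M` as a subset of the unit sphere. -/
def normalSpace (M : Set E) (x : E) : Submodule ℝ E :=
  (tangentSpace M x ⊔ Submodule.span ℝ {x})ᗮ

/-- `II` is the second fundamental form at `x` of `M` as a submanifold of the unit sphere:
on tangent vectors it is symmetric with values in the normal space, and
`II (γ'(0), γ'(0))` is the normal part of `γ''(0)` for every curve `γ` in `M` through `x`.
Every tangent vector is asked to be a velocity, so that `II` is uniquely determined on tangent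
vectors; its values on other vectors are irrelevant and never used. -/
structure IsSecondFundamentalForm (M : Set E) (x : E) (II : E →ₗ[ℝ] E →ₗ[ℝ] E) : Prop where
  velocity : ∀ v ∈ tangentSpace M x, ∃ γ : ℝ → E, IsCurveIn M x γ ∧ deriv γ 0 = v
  symm : ∀ u ∈ tangentSpace M x, ∀ v ∈ tangentSpace M x, II u v = II v u
  mem_normal : ∀ u ∈ tangentSpace M x, ∀ v ∈ tangentSpace M x, II u v ∈ normalSpace M x
  curve : ∀ γ : ℝ → E, IsCurveIn M x γ → ∀ n ∈ normalSpace M x,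
    ⟪II (deriv γ 0) (deriv γ 0), n⟫_ℝ = ⟪deriv (deriv γ) 0, n⟫_ℝ

/-- The eigenspace with eigenvalue `c` of the shape operator `S_n` at `x`, which is defined by
`⟪S_n v, w⟫ = ⟪II (v, w), n⟫` for tangent vectors `v`, `w`. -/
def shapeEigenspace (M : Set E) (x : E) (II : E →ₗ[ℝ] E →ₗ[ℝ] E) (n : E) (c : ℝ) :
    Submodule ℝ E where
  carrier := {v | v ∈ tangentSpace M x ∧ ∀ w ∈ tangentSpace M x, ⟪II v w, n⟫_ℝ = c * ⟪v, w⟫_ℝ}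
  zero_mem' := ⟨Submodule.zero_mem _, fun w _ => by simp⟩
  add_mem' := fun {u v} hu hv => ⟨Submodule.add_mem _ hu.1 hv.1, fun w hw => by
    rw [map_add, LinearMap.add_apply, inner_add_left, inner_add_left, hu.2 w hw, hv.2 w hw,
      mul_add]⟩
  smul_mem' := fun r v hv => ⟨Submodule.smul_mem _ r hv.1, fun w hw => by
    rw [map_smul, LinearMap.smul_apply, real_inner_smul_left, real_inner_smul_left, hv.2 w hw]
    ring⟩

/-- Condition A at `x`: the shape operators in all normal directions have the same kernel. -/
def ConditionA (M : Set E) (x : E) : Prop :=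
  ∃ II : E →ₗ[ℝ] E →ₗ[ℝ] E, IsSecondFundamentalForm M x II ∧
    ∃ K : Submodule ℝ E, ∀ n ∈ normalSpace M x, n ≠ 0 → shapeEigenspace M x II n 0 = K

/-- The focal submanifold `M₊` of the isoparametric family with Cartan–Münzner polynomial `F`. -/
def focalPlus (F : E → ℝ) : Set E := {z | ‖z‖ = 1 ∧ F z = 1}

/-- The focal submanifold `M₋` of the isoparametric family with Cartan–Münzner polynomial `F`. -/
def focalMinus (F : E → ℝ) : Set E := {z | ‖z‖ = 1 ∧ F z = -1}

/-- `x⋆ = (x + n₀) / √2`. -/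
def mirrorMinus (x n₀ : E) : E := (√2)⁻¹ • (x + n₀)

/-- `n₀⋆ = (x - n₀) / √2`. -/
def mirrorNormal (x n₀ : E) : E := (√2)⁻¹ • (x - n₀)

/-- `x ∈ M₊` is a point of Condition A and `n₀` is a unit normal vector of `M₊` at `x`. Then
`x# = n₀ ∈ M₊`, with normal vector `x`, and `x⋆ = (x + n₀) / √2 ∈ M₋` are the mirror points
of `x`. -/
structure IsMirrorPair (F : E → ℝ) (x n₀ : E) : Prop where
  mem : x ∈ focalPlus F
  conditionA : ConditionA (focalPlus F) x
  normal : n₀ ∈ normalSpace (focalPlus F) x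
  unit : ‖n₀‖ = 1
  mem_sharp : n₀ ∈ focalPlus F
  mem_star : mirrorMinus x n₀ ∈ focalMinus F

/-- Orthonormal identifications at the mirror points in which the orthogonal multiplication
is `op`. Here `φp`, `φm`, `ν'` identify the eigenspaces `V₊`, `V₋`, `V₀` of the shape operator
`S_{n₀}` of `M₊` at `x` with `𝕆`, `𝕆`, `Im 𝕆`, and `ν` identifies the orthogonal complement of
`n₀` in the normal space at `x` with `Im 𝕆`. -/
structure IsMirrorFrame (F : E → ℝ) (x n₀ : E) (op : Oct →ₗ[ℝ] Oct →ₗ[ℝ] Oct)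
    (II IIsharp IIstar : E →ₗ[ℝ] E →ₗ[ℝ] E)
    (φp φm : Oct →ₗᵢ[ℝ] E) (ν ν' : ImOct →ₗᵢ[ℝ] E) : Prop where
  /- At `x`: the `A`-blocks of the second fundamental matrices are `A_a = J_a`, that is,
  `p_a (U, U) = 2 ⟪e_a v, u⟫` for `U = u + v + y` in `V₊ ⊕ V₋ ⊕ V₀`. -/
  form : IsSecondFundamentalForm (focalPlus F) x II
  tangent : tangentSpace (focalPlus F) x =
    LinearMap.range φp.toLinearMap ⊔ LinearMap.range φm.toLinearMap ⊔
      LinearMap.range ν'.toLinearMap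
  normal : LinearMap.range ν.toLinearMap =
    normalSpace (focalPlus F) x ⊓ (Submodule.span ℝ {n₀})ᗮ
  eigen_pos : LinearMap.range φp.toLinearMap = shapeEigenspace (focalPlus F) x II n₀ 1
  eigen_neg : LinearMap.range φm.toLinearMap = shapeEigenspace (focalPlus F) x II n₀ (-1)
  eigen_zero : LinearMap.range ν'.toLinearMap = shapeEigenspace (focalPlus F) x II n₀ 0
  form_eq : ∀ (a y : ImOct) (u v : Oct),
    ⟪II (φp u + φm v + ν' y) (φp u + φm v + ν' y), ν a⟫_ℝ = 2 * ⟪octMul a v, u⟫_ℝ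
  /- At `x# = n₀` with normal vector `x`: the `A`-blocks of the second fundamental matrices are
  the left multiplications of the operation `op`. -/
  form_sharp : IsSecondFundamentalForm (focalPlus F) n₀ IIsharp
  tangent_sharp : tangentSpace (focalPlus F) n₀ =
    LinearMap.range φp.toLinearMap ⊔ LinearMap.range φm.toLinearMap ⊔
      LinearMap.range ν.toLinearMap
  normal_sharp : LinearMap.range ν'.toLinearMap =
    normalSpace (focalPlus F) n₀ ⊓ (Submodule.span ℝ {x})ᗮ
  eigen_sharp_pos : LinearMap.range φp.toLinearMap =
    shapeEigenspace (focalPlus F) n₀ IIsharp x 1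
  eigen_sharp_neg : LinearMap.range φm.toLinearMap =
    shapeEigenspace (focalPlus F) n₀ IIsharp x (-1)
  eigen_sharp_zero : LinearMap.range ν.toLinearMap =
    shapeEigenspace (focalPlus F) n₀ IIsharp x 0
  form_sharp_eq : ∀ (a y : ImOct) (u v : Oct),
    ⟪IIsharp (φp u + φm v + ν y) (φp u + φm v + ν y), ν' a⟫_ℝ = 2 * ⟪op a v, u⟫_ℝ
  /- At `x⋆`: for `W = X ⊕ Y ⊕ Z` in the eigenspaces `V₊⋆`, `V₋⋆`, `V₀⋆`, the second fundamental
  form is `(|X|² - |Y|²) n₀⋆ - √2 (X Z + Y ∘ Z)`. -/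
  form_star : IsSecondFundamentalForm (focalMinus F) (mirrorMinus x n₀) IIstar
  tangent_star : tangentSpace (focalMinus F) (mirrorMinus x n₀) =
    LinearMap.range ν.toLinearMap ⊔ LinearMap.range ν'.toLinearMap ⊔
      LinearMap.range φm.toLinearMap
  normal_star : normalSpace (focalMinus F) (mirrorMinus x n₀) =
    Submodule.span ℝ {mirrorNormal x n₀} ⊔ LinearMap.range φp.toLinearMap
  eigen_star_pos : LinearMap.range ν.toLinearMap =
    shapeEigenspace (focalMinus F) (mirrorMinus x n₀) IIstar (mirrorNormal x n₀) 1
  eigen_star_neg : LinearMap.range ν'.toLinearMap =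
    shapeEigenspace (focalMinus F) (mirrorMinus x n₀) IIstar (mirrorNormal x n₀) (-1)
  eigen_star_zero : LinearMap.range φm.toLinearMap =
    shapeEigenspace (focalMinus F) (mirrorMinus x n₀) IIstar (mirrorNormal x n₀) 0
  form_star_eq : ∀ (X Y : ImOct) (Z : Oct),
    IIstar (ν X + ν' Y + φm Z) (ν X + ν' Y + φm Z) =
      (‖X‖ ^ 2 - ‖Y‖ ^ 2) • mirrorNormal x n₀ + φp (-(√2 • (octMul X Z + op Y Z)))

/-- `z` is a mirror point on `M₋` at which the orthogonal multiplication is `op`. -/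
def IsMirrorPointWithMultiplication (F : E → ℝ) (z : E) (op : Oct →ₗ[ℝ] Oct →ₗ[ℝ] Oct) : Prop :=
  ∃ x n₀ : E, IsMirrorPair F x n₀ ∧ z = mirrorMinus x n₀ ∧
    ∃ (II IIsharp IIstar : E →ₗ[ℝ] E →ₗ[ℝ] E) (φp φm : Oct →ₗᵢ[ℝ] E) (ν ν' : ImOct →ₗᵢ[ℝ] E),
      IsMirrorFrame F x n₀ op II IIsharp IIstar φp φm ν ν'

end Geometry

/-! ### The octonionic Ferus–Karcher–Münzner setup -/

/-- `ℝ³² = 𝕆 ⊕ 𝕆 ⊕ 𝕆 ⊕ 𝕆`, with the Euclidean inner product. -/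
abbrev Oct4 : Type := PiLp 2 (fun _ : Fin 4 => Oct)

/-- The vector `(A, X, Y, B)`. -/
def Oct4.mk (A X Y B : Oct) : Oct4 := WithLp.toLp 2 ![A, X, Y, B]

/-- `P₋₁ : (A, X, Y, B) ↦ (A, -X, Y, -B)`. -/
def cliffNeg (z : Oct4) : Oct4 := Oct4.mk (z 0) (-z 1) (z 2) (-z 3)

/-- `P_a : (A, X, Y, B) ↦ (-X e_a, -A ē_a, -B ∘ ē_a, -Y ∘ e_a)` for `0 ≤ a ≤ 7`. -/
def cliff (op : Oct →ₗ[ℝ] Oct →ₗ[ℝ] Oct) (a : Fin 8) (z : Oct4) : Oct4 :=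
  Oct4.mk (-octMul (z 1) (octBasis a)) (-octMul (z 0) (octConj (octBasis a)))
    (-op (z 3) (octConj (octBasis a))) (-op (z 2) (octBasis a))

/-- The Cartan–Münzner polynomial of the isoparametric family defined by the Clifford system
`P₋₁, P₀, …, P₇`, with the sign for which `M₋` is the zero locus in the unit sphere of the
functions `⟪P_i z, z⟫`. The isoparametric hypersurfaces are its level sets `-1 < F < 1` in the
unit sphere. -/
def fkmPolynomial (op : Oct →ₗ[ℝ] Oct →ₗ[ℝ] Oct) (z : Oct4) : ℝ :=
  -‖z‖ ^ 4 + 2 * (⟪cliffNeg z, z⟫_ℝ ^ 2 + ∑ a, ⟪cliff op a z, z⟫_ℝ ^ 2)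

/-- The point `(0, e₀, -e₀, 0) / √2` of `M₋`. -/
def standardMirrorPoint : Oct4 :=
  mirrorMinus (Oct4.mk 0 0 (-octOne) 0) (Oct4.mk 0 octOne 0 0)

end Isoparametric

end

namespace Isoparametric

/-! Algebra. Polarizing |x ∘ y| = |x||y| shows that the adjoint of a left or right multiplication is
the multiplication by the conjugate. Hence the right multiplications by e₁, …, e₇ are anticommuting
complex structures on 𝕆. `exists_clifford_eigenvector` finds a common eigenvector w of four
commuting involutions built from them. On w the products of generators follow the octonion table up
to one global sign E (`exists_octonionic_vector`). So (w ∘ x) ∘ y = w ∘ (x ∘' y), where ∘' is the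
octonion product for E = 1 and its opposite for E = -1 (`exists_octonionic_unit`). The basis vectors
enter P_a only as right factors, so undoing left multiplication by w on the components Y and B
intertwines the two Clifford systems (`exists_isometry_cliff`).

Geometry. At the standard point the multiplication is ∘ itself, for every normalized ∘
(`isMirrorPoint_standard`). Applying this to ∘' and pulling back along the intertwining isometry
gives the required mirror point (`IsMirrorPointWithMultiplication.isometry`).

To compute at the standard point, put p = |A|² + |Y|², m = |X|² + |B|² and r = X̄A + Ȳ∘B. In the
unit sphere, M₋ is given by r = 0 and p = m, while M₊ is the equality case |r|² = pm of a
Cauchy–Schwarz inequality. That equality forces pX = A r̄ and mY = B ∘ r̄ (`focalPlus_eq_one`,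
`focalPlus_eq_two`). Two derivatives of these equations along a curve confine its velocity and give
the normal part of its acceleration (`curve_base`, `curve_sharp`, `curve_star`). Explicit curves
realize every remaining velocity, so the tangent spaces and second fundamental forms are known
exactly. -/

/-! ### Octonion coordinates and identities of normalized orthogonal multiplications. -/

theorem Oct.inner_eq (x y : Oct) : ⟪x, y⟫_ℝ =
    x.fst.re * y.fst.re + x.fst.imI * y.fst.imI + x.fst.imJ * y.fst.imJ + x.fst.imK * y.fst.imK +
    (x.snd.re * y.snd.re + x.snd.imI * y.snd.imI + x.snd.imJ * y.snd.imJ +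
      x.snd.imK * y.snd.imK) := by
  rw [WithLp.prod_inner_apply]
  simp only [Quaternion.inner_def, Quaternion.re_mul, Quaternion.re_star, Quaternion.imI_star,
    Quaternion.imJ_star, Quaternion.imK_star]
  simp only [WithLp.fst, WithLp.snd]
  ring

theorem Oct.norm_sq_eq (x : Oct) : ‖x‖ ^ 2 =
    x.fst.re ^ 2 + x.fst.imI ^ 2 + x.fst.imJ ^ 2 + x.fst.imK ^ 2 +
    (x.snd.re ^ 2 + x.snd.imI ^ 2 + x.snd.imJ ^ 2 + x.snd.imK ^ 2) := by
  rw [← real_inner_self_eq_norm_sq, Oct.inner_eq]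
  ring

theorem octMul_fst (x y : Oct) :
    (octMul x y).fst = x.fst * y.fst - star y.snd * x.snd := rfl

theorem octMul_snd (x y : Oct) :
    (octMul x y).snd = y.snd * x.fst + x.snd * star y.fst := rfl

theorem Oct.ext_iff' (x y : Oct) : x = y ↔
    (x.fst.re = y.fst.re ∧ x.fst.imI = y.fst.imI ∧ x.fst.imJ = y.fst.imJ ∧
      x.fst.imK = y.fst.imK) ∧
    (x.snd.re = y.snd.re ∧ x.snd.imI = y.snd.imI ∧ x.snd.imJ = y.snd.imJ ∧
      x.snd.imK = y.snd.imK) := by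
  constructor
  · rintro rfl
    simp
  · rintro ⟨⟨h1, h2, h3, h4⟩, h5, h6, h7, h8⟩
    apply WithLp.ofLp_injective
    exact Prod.ext (QuaternionAlgebra.ext h1 h2 h3 h4) (QuaternionAlgebra.ext h5 h6 h7 h8)

theorem Oct.mk_fst (a b : ℍ[ℝ]) : (Oct.mk a b).fst = a := rfl

theorem Oct.mk_snd (a b : ℍ[ℝ]) : (Oct.mk a b).snd = b := rfl

theorem Oct.mk_mk_fst (a b c d : ℝ) (y : ℍ[ℝ]) :
    (Oct.mk ⟨a, b, c, d⟩ y).fst = (⟨a, b, c, d⟩ : ℍ[ℝ]) := rfl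

theorem Oct.mk_mk_fst' (a b c d : ℝ) (y : ℍ[ℝ]) :
    (Oct.mk y ⟨a, b, c, d⟩).fst = y := rfl

theorem Oct.mk_mk_snd (a b c d : ℝ) (y : ℍ[ℝ]) :
    (Oct.mk y ⟨a, b, c, d⟩).snd = (⟨a, b, c, d⟩ : ℍ[ℝ]) := rfl

theorem Oct.mk_mk_snd' (a b c d : ℝ) (y : ℍ[ℝ]) :
    (Oct.mk ⟨a, b, c, d⟩ y).snd = y := rfl

theorem octOne_eq : octOne = Oct.mk 1 0 := rfl

theorem octMul_isNormalized : IsNormalizedOrthogonalMultiplication octMul where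
  norm_op x y := by
    rw [← sq_eq_sq₀ (norm_nonneg _) (by positivity), mul_pow]
    simp only [Oct.norm_sq_eq, octMul_fst, octMul_snd, Quaternion.re_sub, Quaternion.re_add,
      Quaternion.re_mul, Quaternion.imI_mul, Quaternion.imJ_mul, Quaternion.imK_mul,
      Quaternion.imI_sub, Quaternion.imJ_sub, Quaternion.imK_sub, Quaternion.imI_add,
      Quaternion.imJ_add, Quaternion.imK_add, Quaternion.re_star, Quaternion.imI_star,
      Quaternion.imJ_star, Quaternion.imK_star]
    ring
  one_op x := by
    rw [octOne_eq, Oct.ext_iff']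
    simp [octMul_fst, octMul_snd, Oct.mk_fst, Oct.mk_snd]
  op_one x := by
    rw [octOne_eq, Oct.ext_iff']
    simp [octMul_fst, octMul_snd, Oct.mk_fst, Oct.mk_snd]

theorem IsNormalizedOrthogonalMultiplication.flip {op : Oct →ₗ[ℝ] Oct →ₗ[ℝ] Oct}
    (h : IsNormalizedOrthogonalMultiplication op) :
    IsNormalizedOrthogonalMultiplication op.flip where
  norm_op x y := by rw [LinearMap.flip_apply, h.norm_op, mul_comm]
  one_op x := h.op_one x
  op_one x := h.one_op x

theorem norm_octOne : ‖octOne‖ = 1 := by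
  rw [← sq_eq_sq₀ (norm_nonneg _) zero_le_one, Oct.norm_sq_eq]
  simp [octOne_eq, Oct.mk_fst, Oct.mk_snd]

/-- This form uses only the inner product and the unit, so conjugation serves every multiplication
with unit e₀ and not just the octonion product. -/
theorem octConj_eq (x : Oct) : octConj x = (2 * ⟪x, octOne⟫_ℝ) • octOne - x := by
  rw [Oct.ext_iff']
  simp [octConj, Oct.inner_eq, octOne_eq, Oct.mk_fst, Oct.mk_snd, -WithLp.prod_inner_apply]
  ring

theorem sum_inner_octBasis_mul (x y : Oct) :
    ∑ a, ⟪octBasis a, x⟫_ℝ * ⟪octBasis a, y⟫_ℝ = ⟪x, y⟫_ℝ := by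
  rw [Oct.inner_eq x y]
  simp [Fin.sum_univ_eight, octBasis, Oct.inner_eq, Oct.mk_fst, Oct.mk_snd, Oct.mk_mk_fst,
    Oct.mk_mk_fst', Oct.mk_mk_snd, Oct.mk_mk_snd', -WithLp.prod_inner_apply]
  ring

theorem octBasis_expansion (x : Oct) : ∑ a, ⟪octBasis a, x⟫_ℝ • octBasis a = x := by
  refine ext_inner_right ℝ fun y => ?_
  rw [sum_inner, ← sum_inner_octBasis_mul]
  simp only [real_inner_smul_left]

theorem sum_inner_octBasis_sq (x : Oct) : ∑ a, ⟪octBasis a, x⟫_ℝ ^ 2 = ‖x‖ ^ 2 := by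
  rw [← real_inner_self_eq_norm_sq, ← sum_inner_octBasis_mul]
  simp only [sq]

theorem mem_ImOct {x : Oct} : x ∈ ImOct ↔ ⟪x, octOne⟫_ℝ = 0 := by
  rw [ImOct, Submodule.mem_orthogonal_singleton_iff_inner_left]

theorem octConj_of_mem {x : Oct} (hx : x ∈ ImOct) : octConj x = -x := by
  rw [octConj_eq, mem_ImOct.1 hx]
  simp

theorem octConj_octOne : octConj octOne = octOne := by
  rw [octConj_eq, real_inner_self_eq_norm_sq, norm_octOne, two_mul, one_pow, add_smul, one_smul,
    add_sub_cancel_right]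

theorem octConj_smul (c : ℝ) (x : Oct) : octConj (c • x) = c • octConj x := by
  simp only [octConj_eq, real_inner_smul_left, smul_sub, smul_smul]
  congr 2
  ring

theorem octConj_add (x y : Oct) : octConj (x + y) = octConj x + octConj y := by
  simp only [octConj_eq, inner_add_left, mul_add, add_smul]
  abel

theorem octConj_neg (x : Oct) : octConj (-x) = -octConj x := by
  simpa using octConj_smul (-1) x

theorem octConj_octConj (x : Oct) : octConj (octConj x) = x := by
  rw [Oct.ext_iff']
  simp [octConj, Oct.mk_fst, Oct.mk_snd]

theorem inner_octConj_octConj (x y : Oct) : ⟪octConj x, octConj y⟫_ℝ = ⟪x, y⟫_ℝ := by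
  simp [octConj, Oct.inner_eq, Oct.mk_fst, Oct.mk_snd, -WithLp.prod_inner_apply]

theorem norm_octConj (x : Oct) : ‖octConj x‖ = ‖x‖ := by
  rw [← sq_eq_sq₀ (norm_nonneg _) (norm_nonneg _), ← real_inner_self_eq_norm_sq,
    inner_octConj_octConj, real_inner_self_eq_norm_sq]

namespace IsNormalizedOrthogonalMultiplication

variable {op : Oct →ₗ[ℝ] Oct →ₗ[ℝ] Oct} (h : IsNormalizedOrthogonalMultiplication op)
include h

theorem inner_op_left (x y z : Oct) : ⟪op x y, op x z⟫_ℝ = ‖x‖ ^ 2 * ⟪y, z⟫_ℝ := by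
  have := h.norm_op x (y + z)
  have h2 : ‖op x y + op x z‖ ^ 2 = ‖x‖ ^ 2 * ‖y + z‖ ^ 2 := by
    rw [← map_add, this, mul_pow]
  rw [norm_add_sq_real, norm_add_sq_real, h.norm_op, h.norm_op] at h2
  linarith

/-- Polarization of the norm identity in both factors; setting x' = e₀ then yields the adjoint of a
left multiplication. -/
theorem inner_op_left_add (x x' y z : Oct) :
    ⟪op x y, op x' z⟫_ℝ + ⟪op x' y, op x z⟫_ℝ = 2 * ⟪x, x'⟫_ℝ * ⟪y, z⟫_ℝ := by
  have h1 := h.inner_op_left (x + x') y z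
  rw [norm_add_sq_real, map_add, LinearMap.add_apply, LinearMap.add_apply, inner_add_left,
    inner_add_right, inner_add_right, h.inner_op_left, h.inner_op_left] at h1
  linarith

theorem inner_op_eq_left (x y z : Oct) : ⟪op x y, z⟫_ℝ = ⟪y, op (octConj x) z⟫_ℝ := by
  have h1 := h.inner_op_left_add x octOne y z
  rw [h.one_op, h.one_op] at h1
  rw [octConj_eq, map_sub, map_smul, LinearMap.sub_apply, LinearMap.smul_apply, h.one_op,
    inner_sub_right, real_inner_smul_right]
  linarith

theorem inner_op_eq_right (x y z : Oct) : ⟪op x y, z⟫_ℝ = ⟪x, op z (octConj y)⟫_ℝ :=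
  h.flip.inner_op_eq_left y x z

/-- Left multiplication by x is |x| times an isometry, so composing it with its adjoint gives |x|².
-/
theorem op_conj_op (x y : Oct) : op (octConj x) (op x y) = ‖x‖ ^ 2 • y := by
  refine ext_inner_left ℝ fun z => ?_
  rw [← h.inner_op_eq_left, h.inner_op_left, real_inner_smul_right]

theorem op_op_conj (x y : Oct) : op (op y x) (octConj x) = ‖x‖ ^ 2 • y :=
  h.flip.op_conj_op x y

end IsNormalizedOrthogonalMultiplication

theorem ext_octBasis {V : Type*} [AddCommGroup V] [Module ℝ V] {B B' : Oct →ₗ[ℝ] Oct →ₗ[ℝ] V}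
    (h : ∀ i j, B (octBasis i) (octBasis j) = B' (octBasis i) (octBasis j)) : B = B' := by
  ext1 x
  ext1 y
  obtain ⟨c, hc⟩ : ∃ c : Fin 8 → ℝ, x = ∑ a, c a • octBasis a := ⟨_, (octBasis_expansion x).symm⟩
  obtain ⟨d, hd⟩ : ∃ d : Fin 8 → ℝ, y = ∑ a, d a • octBasis a := ⟨_, (octBasis_expansion y).symm⟩
  rw [hc, hd]
  simp only [map_sum, map_smul, LinearMap.sum_apply, LinearMap.smul_apply, h]

theorem inner_octBasis (i j : Fin 8) :
    ⟪octBasis i, octBasis j⟫_ℝ = if i = j then 1 else 0 := by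
  rw [Oct.inner_eq]
  fin_cases i <;> fin_cases j <;>
  simp [octBasis, Oct.mk_fst, Oct.mk_snd, Oct.mk_mk_fst, Oct.mk_mk_fst',
    Oct.mk_mk_snd, Oct.mk_mk_snd']

theorem octBasis_mem_ImOct {i : Fin 8} (hi : i ≠ 0) : octBasis i ∈ ImOct := by
  rw [mem_ImOct, octOne, inner_octBasis, if_neg hi]

namespace IsNormalizedOrthogonalMultiplication

variable {op : Oct →ₗ[ℝ] Oct →ₗ[ℝ] Oct} (h : IsNormalizedOrthogonalMultiplication op)
include h

theorem op_op_self {x : Oct} (hx : x ∈ ImOct) (y : Oct) : op (op y x) x = -(‖x‖ ^ 2 • y) := by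
  rw [← h.op_op_conj x y, octConj_of_mem hx, map_neg, neg_neg]

/-- Polarizing `op_op_self` gives the Clifford relations for right multiplications by imaginary
elements. -/
theorem op_op_add {x x' : Oct} (hx : x ∈ ImOct) (hx' : x' ∈ ImOct) (y : Oct) :
    op (op y x) x' + op (op y x') x = -((2 * ⟪x, x'⟫_ℝ) • y) := by
  have h1 := h.op_op_self (ImOct.add_mem hx hx') y
  simp only [map_add, LinearMap.add_apply, h.op_op_self hx, h.op_op_self hx',
    norm_add_sq_real, add_smul, neg_add] at h1
  have h2 : op (op y x) x' + op (op y x') x =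
    (-(‖x‖ ^ 2 • y) + op (op y x') x + (op (op y x) x' + -(‖x'‖ ^ 2 • y))) +
      (‖x‖ ^ 2 • y) + (‖x'‖ ^ 2 • y) := by abel
  rw [h2, h1]
  abel

theorem op_octBasis_self {i : Fin 8} (hi : i ≠ 0) (y : Oct) :
    op (op y (octBasis i)) (octBasis i) = -y := by
  rw [h.op_op_self (octBasis_mem_ImOct hi), ← real_inner_self_eq_norm_sq, inner_octBasis,
    if_pos rfl, one_smul]

theorem op_octBasis_anticomm {i j : Fin 8} (hi : i ≠ 0) (hj : j ≠ 0) (hij : i ≠ j) (y : Oct) :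
    op (op y (octBasis i)) (octBasis j) = -op (op y (octBasis j)) (octBasis i) := by
  rw [eq_neg_iff_add_eq_zero, h.op_op_add (octBasis_mem_ImOct hi) (octBasis_mem_ImOct hj),
    inner_octBasis, if_neg hij]
  simp

end IsNormalizedOrthogonalMultiplication

/-! ### Common eigenvectors of Clifford generators. -/

section Clifford

variable {V : Type*} [AddCommGroup V] [Module ℝ V]

/-- An eigenvector with prescribed sign of an involution that anticommutes with a complex
structure. -/
theorem exists_eigenvector_of_anticomm (S : Submodule ℝ V) (T U : V →ₗ[ℝ] V)
    (hT : ∀ v, T (T v) = v) (hTU : ∀ v, T (U v) = -U (T v)) (hU : ∀ v, U (U v) = -v)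
    (hTS : ∀ v ∈ S, T v ∈ S) (hUS : ∀ v ∈ S, U v ∈ S) {s : ℝ} (hs : s * s = 1)
    (hS : ∃ v ∈ S, v ≠ 0) : ∃ w ∈ S, T w = s • w ∧ w ≠ 0 := by
  obtain ⟨v, hv, hv0⟩ := hS
  -- v + sTv is twice the projection of v to the s-eigenspace. If it vanishes, v has eigenvalue -s
  -- and U moves it to eigenvalue s.
  by_cases hc : v + s • T v = 0
  · refine ⟨U v, hUS v hv, ?_, fun h0 => hv0 ?_⟩
    · have h1 : s • (v + s • T v) = 0 := by rw [hc, smul_zero]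
      rw [smul_add, smul_smul, hs, one_smul, add_eq_zero_iff_eq_neg] at h1
      rw [hTU, ← map_neg, ← h1, map_smul]
    · have := hU v
      rwa [h0, map_zero, eq_comm, neg_eq_zero] at this
  · refine ⟨_, S.add_mem hv (S.smul_mem s (hTS v hv)), ?_, hc⟩
    rw [map_add, map_smul, hT, smul_add, smul_smul, hs, one_smul, add_comm]

theorem exists_eigenvector_of_involution (T : V →ₗ[ℝ] V) (hT : ∀ v, T (T v) = v)
    (hV : ∃ v : V, v ≠ 0) : ∃ s : ℝ, s * s = 1 ∧ ∃ w, T w = s • w ∧ w ≠ 0 := by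
  obtain ⟨v, hv⟩ := hV
  by_cases hc : v + T v = 0
  · exact ⟨-1, by norm_num, v, by rw [neg_one_smul, eq_neg_iff_add_eq_zero, add_comm, hc], hv⟩
  · exact ⟨1, by norm_num, _, by rw [map_add, hT, one_smul, add_comm], hc⟩

variable (R : Fin 8 → V →ₗ[ℝ] V) (hsq : ∀ i v, i ≠ 0 → R i (R i v) = -v)
  (hanti : ∀ i j v, 0 < j → j < i → R i (R j v) = -R j (R i v))
include hsq hanti

/-- The four words are commuting involutions. The word of length seven commutes with all generators,
so its sign s cannot be chosen. The three words of length three can be given the same sign one after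
another: R₄, R₂, R₁ each anticommute with the word being adjusted and commute with those already
settled. With `hanti` restricted to j < i, `simp` sorts words into a normal form. -/
theorem exists_clifford_eigenvector (hV : ∃ v : V, v ≠ 0) :
    ∃ s : ℝ, s * s = 1 ∧ ∃ w, w ≠ 0 ∧
      R 7 (R 6 (R 5 (R 4 (R 3 (R 2 (R 1 w)))))) = s • w ∧ R 3 (R 2 (R 1 w)) = s • w ∧
      R 5 (R 4 (R 1 w)) = s • w ∧ R 6 (R 4 (R 2 w)) = s • w := by
  let T₀ := R 7 ∘ₗ R 6 ∘ₗ R 5 ∘ₗ R 4 ∘ₗ R 3 ∘ₗ R 2 ∘ₗ R 1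
  let T₁ := R 3 ∘ₗ R 2 ∘ₗ R 1
  let T₂ := R 5 ∘ₗ R 4 ∘ₗ R 1
  let T₃ := R 6 ∘ₗ R 4 ∘ₗ R 2
  obtain ⟨s, hs, w₀, hw₀, hw₀'⟩ := exists_eigenvector_of_involution T₀
    (by intro v; simp [T₀, hsq, hanti]) hV
  let S₀ := LinearMap.eqLocus T₀ (s • LinearMap.id)
  let S₁ := S₀ ⊓ LinearMap.eqLocus T₁ (s • LinearMap.id)
  let S₂ := S₁ ⊓ LinearMap.eqLocus T₂ (s • LinearMap.id)
  have comm : ∀ (T T' : V →ₗ[ℝ] V), (∀ v, T (T' v) = T' (T v)) → ∀ v,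
      T v = s • v → T (T' v) = s • T' v := by
    intro T T' hTT v hv
    rw [hTT, hv, map_smul]
  obtain ⟨w₁, hw₁, hw₁s, hw₁'⟩ := exists_eigenvector_of_anticomm S₀ T₁ (R 4)
    (by intro v; simp [T₁, hsq, hanti]) (by intro v; simp [T₁, hanti])
    (fun v => hsq 4 v (by decide))
    (fun v hv => comm T₀ T₁ (by intro v; simp [T₀, T₁, hsq, hanti]) v hv)
    (fun v hv => comm T₀ (R 4) (by intro v; simp [T₀, hsq, hanti]) v hv) hs ⟨w₀, hw₀, hw₀'⟩
  obtain ⟨w₂, hw₂, hw₂s, hw₂'⟩ := exists_eigenvector_of_anticomm S₁ T₂ (R 2)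
    (by intro v; simp [T₂, hsq, hanti]) (by intro v; simp [T₂, hanti])
    (fun v => hsq 2 v (by decide))
    (fun v hv => ⟨comm T₀ T₂ (by intro v; simp [T₀, T₂, hsq, hanti]) v hv.1,
      comm T₁ T₂ (by intro v; simp [T₁, T₂, hsq, hanti]) v hv.2⟩)
    (fun v hv => ⟨comm T₀ (R 2) (by intro v; simp [T₀, hsq, hanti]) v hv.1,
      comm T₁ (R 2) (by intro v; simp [T₁, hsq, hanti]) v hv.2⟩) hs
    ⟨w₁, ⟨hw₁, hw₁s⟩, hw₁'⟩
  obtain ⟨w₃, hw₃, hw₃s, hw₃'⟩ := exists_eigenvector_of_anticomm S₂ T₃ (R 1)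
    (by intro v; simp [T₃, hsq, hanti]) (by intro v; simp [T₃, hanti])
    (fun v => hsq 1 v (by decide))
    (fun v hv => ⟨⟨comm T₀ T₃ (by intro v; simp [T₀, T₃, hsq, hanti]) v hv.1.1,
      comm T₁ T₃ (by intro v; simp [T₁, T₃, hsq, hanti]) v hv.1.2⟩,
      comm T₂ T₃ (by intro v; simp [T₂, T₃, hsq, hanti]) v hv.2⟩)
    (fun v hv => ⟨⟨comm T₀ (R 1) (by intro v; simp [T₀, hsq, hanti]) v hv.1.1,
      comm T₁ (R 1) (by intro v; simp [T₁, hsq, hanti]) v hv.1.2⟩,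
      comm T₂ (R 1) (by intro v; simp [T₂, hsq, hanti]) v hv.2⟩) hs
    ⟨w₂, ⟨hw₂, hw₂s⟩, hw₂'⟩
  exact ⟨s, hs, w₃, hw₃', hw₃.1.1, hw₃.1.2, hw₃.2, hw₃s⟩

/-- A vector on which the products of the generators follow, up to a global sign, the
multiplication table of the octonions. -/
theorem exists_octonionic_vector (hV : ∃ v : V, v ≠ 0) :
    ∃ E : ℝ, E * E = 1 ∧ ∃ w, w ≠ 0 ∧ R 2 (R 1 w) = E • R 3 w ∧ R 4 (R 1 w) = E • R 5 w ∧
      R 4 (R 2 w) = E • R 6 w ∧ R 4 (R 3 w) = E • R 7 w ∧ R 7 (R 1 w) = E • R 6 w ∧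
      R 5 (R 2 w) = E • R 7 w ∧ R 6 (R 3 w) = E • R 5 w := by
  obtain ⟨s, hs, w, hw, h₀, h₁, h₂, h₃⟩ := exists_clifford_eigenvector R hsq hanti hV
  have key : ∀ i v, i ≠ 0 → R i v = s • w → v = -(s • R i w) := by
    intro i v hi h
    rw [← map_smul, ← h, hsq i v hi, neg_neg]
  have h1 := key 3 _ (by decide) h₁
  have h2 := key 5 _ (by decide) h₂
  have h3 := key 6 _ (by decide) h₃
  have inv : ∀ {u v : V}, u = -(s • v) → v = -(s • u) := by
    intro u v h
    rw [h, smul_neg, smul_smul, hs, one_smul, neg_neg]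
  -- R₃w, R₅w, R₆w and R₇w become words in R₁, R₂, R₄ applied to w. The seven relations then reduce
  -- to comparing sorted words, with global sign E = -s.
  have f3 := inv h1
  have f5 := inv h2
  have f6 := inv h3
  have f7 : R 7 w = R 1 (R 4 (R 2 w)) := by
    rw [inv (key 7 _ (by decide) h₀)]
    simp [hsq, hanti, f3, f5, f6, smul_smul, hs]
  refine ⟨-s, by linarith, w, hw, ?_, ?_, ?_, ?_, ?_, ?_, ?_⟩ <;>
  simp [hsq, hanti, f3, f5, f6, f7, smul_smul, hs]

end Clifford

/-! ### From the Fano plane to the octonion product. -/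

/-- One oriented pair on a line determines the other five: E² = 1 lets the relation be solved for w
∘ e_k, and then squares and anticommutation of the right multiplications do the rest. -/
theorem IsNormalizedOrthogonalMultiplication.octBasis_line
    {op : Oct →ₗ[ℝ] Oct →ₗ[ℝ] Oct} (h : IsNormalizedOrthogonalMultiplication op) {E : ℝ}
    (hE : E * E = 1) {w : Oct} {i j k : Fin 8} (hi : i ≠ 0) (hj : j ≠ 0) (hk : k ≠ 0)
    (hij : i ≠ j) (hik : i ≠ k) (hjk : j ≠ k)
    (hw : op (op w (octBasis i)) (octBasis j) = E • op w (octBasis k)) :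
    op (op w (octBasis j)) (octBasis i) = -(E • op w (octBasis k)) ∧
    op (op w (octBasis j)) (octBasis k) = E • op w (octBasis i) ∧
    op (op w (octBasis k)) (octBasis j) = -(E • op w (octBasis i)) ∧
    op (op w (octBasis k)) (octBasis i) = E • op w (octBasis j) ∧
    op (op w (octBasis i)) (octBasis k) = -(E • op w (octBasis j)) := by
  have hw' : op w (octBasis k) = E • op (op w (octBasis i)) (octBasis j) := by
    rw [hw, smul_smul, hE, one_smul]
  have h1 : op (op w (octBasis k)) (octBasis j) = -(E • op w (octBasis i)) := by
    rw [hw', map_smul, LinearMap.smul_apply, h.op_octBasis_self hj, smul_neg]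
  have h2 : op (op w (octBasis k)) (octBasis i) = E • op w (octBasis j) := by
    rw [hw', map_smul, LinearMap.smul_apply, h.op_octBasis_anticomm hi hj hij, map_neg,
      LinearMap.neg_apply, h.op_octBasis_self hi, neg_neg]
  refine ⟨?_, ?_, h1, h2, ?_⟩
  · rw [h.op_octBasis_anticomm hj hi hij.symm, hw]
  · rw [h.op_octBasis_anticomm hj hk hjk, h1, neg_neg]
  · rw [h.op_octBasis_anticomm hi hk hik, h2]

/-- The seven lines of the Fano plane, with the orientations that occur in
`exists_octonionic_vector`. -/
theorem octMul_octBasis_lines :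
    octMul (octBasis 1) (octBasis 2) = octBasis 3 ∧ octMul (octBasis 1) (octBasis 4) = octBasis 5 ∧
    octMul (octBasis 2) (octBasis 4) = octBasis 6 ∧ octMul (octBasis 3) (octBasis 4) = octBasis 7 ∧
    octMul (octBasis 1) (octBasis 7) = octBasis 6 ∧ octMul (octBasis 2) (octBasis 5) = octBasis 7 ∧
    octMul (octBasis 3) (octBasis 6) = octBasis 5 := by
  refine ⟨?_, ?_, ?_, ?_, ?_, ?_, ?_⟩ <;> rw [Oct.ext_iff'] <;>
  simp only [octMul_fst, octMul_snd, Quaternion.re_sub, Quaternion.re_add,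
    Quaternion.re_mul, Quaternion.imI_mul, Quaternion.imJ_mul, Quaternion.imK_mul,
    Quaternion.imI_sub, Quaternion.imJ_sub, Quaternion.imK_sub, Quaternion.imI_add,
    Quaternion.imJ_add, Quaternion.imK_add, Quaternion.re_star, Quaternion.imI_star,
    Quaternion.imJ_star, Quaternion.imK_star] <;>
  simp [octBasis, Oct.mk_fst, Oct.mk_snd, Oct.mk_mk_fst,
    Oct.mk_mk_fst', Oct.mk_mk_snd, Oct.mk_mk_snd']

namespace IsNormalizedOrthogonalMultiplication

variable {op : Oct →ₗ[ℝ] Oct →ₗ[ℝ] Oct} (h : IsNormalizedOrthogonalMultiplication op)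
include h

/-- Both multiplications obey the same propagation rule along a line, so agreement on one oriented
pair per line suffices. Any two distinct imaginary units lie on a common line. -/
theorem op_op_octBasis_of_lines {E : ℝ} (hE : E * E = 1) {w : Oct}
    (h1 : op (op w (octBasis 1)) (octBasis 2) = E • op w (octBasis 3))
    (h2 : op (op w (octBasis 1)) (octBasis 4) = E • op w (octBasis 5))
    (h3 : op (op w (octBasis 2)) (octBasis 4) = E • op w (octBasis 6))
    (h4 : op (op w (octBasis 3)) (octBasis 4) = E • op w (octBasis 7))
    (h5 : op (op w (octBasis 1)) (octBasis 7) = E • op w (octBasis 6))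
    (h6 : op (op w (octBasis 2)) (octBasis 5) = E • op w (octBasis 7))
    (h7 : op (op w (octBasis 3)) (octBasis 6) = E • op w (octBasis 5))
    {i j : Fin 8} (hi : i ≠ 0) (hj : j ≠ 0) (hij : i ≠ j) :
    op (op w (octBasis i)) (octBasis j) = E • op w (octMul (octBasis i) (octBasis j)) := by
  have ext_line : ∀ {i j k : Fin 8}, i ≠ 0 → j ≠ 0 → k ≠ 0 → i ≠ j → i ≠ k → j ≠ k →
      op (op w (octBasis i)) (octBasis j) = E • op w (octBasis k) →
      octMul (octBasis i) (octBasis j) = octBasis k →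
      ∀ {a b : Fin 8}, (a = i ∨ a = j ∨ a = k) → (b = i ∨ b = j ∨ b = k) → a ≠ b →
      op (op w (octBasis a)) (octBasis b) = E • op w (octMul (octBasis a) (octBasis b)) := by
    intro i j k hi hj hk hij hik hjk hw hm a b ha hb hab
    obtain ⟨w1, w2, w3, w4, w5⟩ := h.octBasis_line hE hi hj hk hij hik hjk hw
    -- The octonion product itself satisfies the line rule with w = e₀ and sign 1.
    have hm' : octMul (octMul octOne (octBasis i)) (octBasis j) =
        (1 : ℝ) • octMul octOne (octBasis k) := by
      rw [octMul_isNormalized.one_op, octMul_isNormalized.one_op, one_smul, hm]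
    obtain ⟨m1, m2, m3, m4, m5⟩ :=
      octMul_isNormalized.octBasis_line (one_mul 1) hi hj hk hij hik hjk hm'
    simp only [octMul_isNormalized.one_op, one_smul] at m1 m2 m3 m4 m5
    rcases ha with rfl | rfl | rfl <;> rcases hb with rfl | rfl | rfl <;>
    first
    | exact absurd rfl hab
    | simp only [hw, hm, w1, w2, w3, w4, w5, m1, m2, m3, m4, m5, map_neg, smul_neg]
  obtain ⟨l1, l2, l3, l4, l5, l6, l7⟩ := octMul_octBasis_lines
  have c1 := @ext_line 1 2 3 (by decide) (by decide) (by decide) (by decide) (by decide)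
    (by decide) h1 l1 i j
  have c2 := @ext_line 1 4 5 (by decide) (by decide) (by decide) (by decide) (by decide)
    (by decide) h2 l2 i j
  have c3 := @ext_line 2 4 6 (by decide) (by decide) (by decide) (by decide) (by decide)
    (by decide) h3 l3 i j
  have c4 := @ext_line 3 4 7 (by decide) (by decide) (by decide) (by decide) (by decide)
    (by decide) h4 l4 i j
  have c5 := @ext_line 1 7 6 (by decide) (by decide) (by decide) (by decide) (by decide)
    (by decide) h5 l5 i j
  have c6 := @ext_line 2 5 7 (by decide) (by decide) (by decide) (by decide) (by decide)
    (by decide) h6 l6 i j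
  have c7 := @ext_line 3 6 5 (by decide) (by decide) (by decide) (by decide) (by decide)
    (by decide) h7 l7 i j
  have cover : ∀ i j : Fin 8, i ≠ 0 → j ≠ 0 → i ≠ j →
      ((i = 1 ∨ i = 2 ∨ i = 3) ∧ (j = 1 ∨ j = 2 ∨ j = 3)) ∨
      ((i = 1 ∨ i = 4 ∨ i = 5) ∧ (j = 1 ∨ j = 4 ∨ j = 5)) ∨
      ((i = 2 ∨ i = 4 ∨ i = 6) ∧ (j = 2 ∨ j = 4 ∨ j = 6)) ∨
      ((i = 3 ∨ i = 4 ∨ i = 7) ∧ (j = 3 ∨ j = 4 ∨ j = 7)) ∨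
      ((i = 1 ∨ i = 7 ∨ i = 6) ∧ (j = 1 ∨ j = 7 ∨ j = 6)) ∨
      ((i = 2 ∨ i = 5 ∨ i = 7) ∧ (j = 2 ∨ j = 5 ∨ j = 7)) ∨
      ((i = 3 ∨ i = 6 ∨ i = 5) ∧ (j = 3 ∨ j = 6 ∨ j = 5)) := by
    intro i j
    fin_cases i <;> fin_cases j <;> simp
  rcases cover i j hi hj hij with c | c | c | c | c | c | c
  exacts [c1 c.1 c.2 hij, c2 c.1 c.2 hij, c3 c.1 c.2 hij, c4 c.1 c.2 hij, c5 c.1 c.2 hij,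
    c6 c.1 c.2 hij, c7 c.1 c.2 hij]

/-- Every normalized orthogonal multiplication becomes the octonion product or its opposite
after a change of the left factor by the multiplication with a suitable unit vector. -/
theorem exists_octonionic_unit :
    ∃ w : Oct, ‖w‖ = 1 ∧ ∃ op' : Oct →ₗ[ℝ] Oct →ₗ[ℝ] Oct,
      ((∀ a b, op' a b = octMul a b) ∨ (∀ a b, op' a b = octMul b a)) ∧
      ∀ x y, op (op w x) y = op w (op' x y) := by
  obtain ⟨E, hE, w, hw, h1, h2, h3, h4, h5, h6, h7⟩ :=
    exists_octonionic_vector (fun i => op.flip (octBasis i))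
      (fun i v hi => h.op_octBasis_self hi v)
      (fun i j v hj hij => h.op_octBasis_anticomm hj.ne' (hj.trans hij).ne' hij.ne v)
      ⟨octOne, fun h0 => by simpa [h0] using norm_octOne⟩
  have table := fun {i j : Fin 8} =>
    h.op_op_octBasis_of_lines (i := i) (j := j) hE h1 h2 h3 h4 h5 h6 h7
  -- Distinct imaginary units anticommute, so the sign E = -1 in the table amounts to exchanging the
  -- factors.
  obtain ⟨op', hop', hn', hE'⟩ : ∃ op' : Oct →ₗ[ℝ] Oct →ₗ[ℝ] Oct,
      ((∀ a b, op' a b = octMul a b) ∨ (∀ a b, op' a b = octMul b a)) ∧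
      IsNormalizedOrthogonalMultiplication op' ∧
      ∀ i j : Fin 8, i ≠ 0 → j ≠ 0 → i ≠ j →
        op' (octBasis i) (octBasis j) = E • octMul (octBasis i) (octBasis j) := by
    rcases mul_self_eq_one_iff.1 hE with rfl | rfl
    · exact ⟨octMul, Or.inl fun _ _ => rfl, octMul_isNormalized, fun _ _ _ _ _ =>
        (one_smul ℝ _).symm⟩
    · refine ⟨octMul.flip, Or.inr fun _ _ => rfl, octMul_isNormalized.flip,
        fun i j hi hj hij => ?_⟩
      have := octMul_isNormalized.op_octBasis_anticomm hj hi hij.symm octOne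
      rw [octMul_isNormalized.one_op, octMul_isNormalized.one_op] at this
      rw [LinearMap.flip_apply, this, neg_one_smul]
  have main : ∀ x y, op (op w x) y = op w (op' x y) := by
    -- Both sides are bilinear, so basis vectors suffice. The unit and the squares are handled by
    -- normalization; only distinct imaginary units need the table.
    have : op ∘ₗ op w = op'.compr₂ (op w) := by
      refine ext_octBasis fun i j => ?_
      rw [LinearMap.comp_apply, LinearMap.compr₂_apply]
      by_cases hi : i = 0
      · rw [hi, ← octOne, h.op_one, hn'.one_op]
      by_cases hj : j = 0
      · rw [hj, ← octOne, h.op_one, hn'.op_one]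
      by_cases hij : i = j
      · have := hn'.op_octBasis_self hj octOne
        rw [hn'.one_op] at this
        rw [hij, h.op_octBasis_self hj, this, map_neg, h.op_one]
      · rw [table hi hj hij, hE' i j hi hj hij, map_smul]
    intro x y
    exact LinearMap.congr_fun₂ this x y
  -- The identity is linear in w, so w may be normalized.
  refine ⟨‖w‖⁻¹ • w, norm_smul_inv_norm hw, op', hop', fun x y => ?_⟩
  simp only [map_smul, LinearMap.smul_apply, main]

end IsNormalizedOrthogonalMultiplication

/-! ### Invariance of the submanifold geometry under linear isometries. -/

section Transport

variable {E E' : Type*} [NormedAddCommGroup E] [InnerProductSpace ℝ E]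
  [NormedAddCommGroup E'] [InnerProductSpace ℝ E'] (Ψ : E' ≃ₗᵢ[ℝ] E)

/-- No differentiability is needed: Ψ is invertible, so both sides take the default value zero where
γ is not differentiable. The identity of functions can thus be applied twice for second derivatives.
-/
theorem deriv_isometry_comp (γ : ℝ → E') : deriv (fun t => Ψ (γ t)) = fun t => Ψ (deriv γ t) := by
  funext t
  have := congrArg (fun L => L 1)
    (Ψ.toContinuousLinearEquiv.comp_fderiv (f := γ) (x := t))
  simpa [fderiv_apply_one_eq_deriv, Function.comp_def] using this

variable {Ψ} {M : Set E} {M' : Set E'} (hM : ∀ z, Ψ z ∈ M ↔ z ∈ M')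
include hM

theorem IsCurveIn.isometry_comp {y : E'} {γ : ℝ → E'} (h : IsCurveIn M' y γ) :
    IsCurveIn M (Ψ y) (fun t => Ψ (γ t)) where
  smooth := Ψ.contDiff.contDiffAt.comp 0 h.smooth
  mem := h.mem.mono fun t ht => (hM _).2 ht
  base := by rw [h.base]

theorem IsCurveIn.symm_comp {y : E'} {γ : ℝ → E} (h : IsCurveIn M (Ψ y) γ) :
    IsCurveIn M' y (fun t => Ψ.symm (γ t)) := by
  have := IsCurveIn.isometry_comp (Ψ := Ψ.symm) (M := M') (M' := M)
    (fun z => by rw [← hM, LinearIsometryEquiv.apply_symm_apply]) h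
  rwa [LinearIsometryEquiv.symm_apply_apply] at this

theorem tangentSpace_isometry (y : E') :
    tangentSpace M (Ψ y) = (tangentSpace M' y).map (Ψ : E' →ₗ[ℝ] E) := by
  rw [tangentSpace, tangentSpace, Submodule.map_span]
  congr 1
  ext v
  constructor
  · rintro ⟨γ, hγ, rfl⟩
    refine ⟨Ψ.symm (deriv γ 0), ⟨_, hγ.symm_comp hM, ?_⟩, Ψ.apply_symm_apply _⟩
    rw [deriv_isometry_comp]
  · rintro ⟨_, ⟨γ, hγ, rfl⟩, rfl⟩
    refine ⟨_, hγ.isometry_comp hM, ?_⟩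
    rw [deriv_isometry_comp]
    rfl

theorem normalSpace_isometry (y : E') :
    normalSpace M (Ψ y) = (normalSpace M' y).map (Ψ : E' →ₗ[ℝ] E) := by
  have h1 : Submodule.span ℝ {Ψ y} = (Submodule.span ℝ {y}).map (Ψ : E' →ₗ[ℝ] E) := by
    rw [Submodule.map_span, Set.image_singleton]
    rfl
  rw [normalSpace, normalSpace, tangentSpace_isometry hM, h1, ← Submodule.map_sup]
  exact (Submodule.map_orthogonal_equiv _ Ψ).symm

/-- The transport of a bilinear form by a linear isometry. -/
def transportForm (Ψ : E' ≃ₗᵢ[ℝ] E) (II : E' →ₗ[ℝ] E' →ₗ[ℝ] E') : E →ₗ[ℝ] E →ₗ[ℝ] E :=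
  (II.compl₁₂ (Ψ.symm : E →ₗ[ℝ] E') (Ψ.symm : E →ₗ[ℝ] E')).compr₂ (Ψ : E' →ₗ[ℝ] E)

omit hM in
theorem transportForm_apply (II : E' →ₗ[ℝ] E' →ₗ[ℝ] E') (u v : E') :
    transportForm Ψ II (Ψ u) (Ψ v) = Ψ (II u v) := by
  simp [transportForm]

/-- The definition speaks only of curves, their derivatives and inner products. A curve in M is
pulled back by the inverse isometry, where the given form applies. -/
theorem IsSecondFundamentalForm.isometry {y : E'} {II : E' →ₗ[ℝ] E' →ₗ[ℝ] E'}
    (h : IsSecondFundamentalForm M' y II) :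
    IsSecondFundamentalForm M (Ψ y) (transportForm Ψ II) where
  velocity := by
    rw [tangentSpace_isometry hM]
    rintro _ ⟨v, hv, rfl⟩
    obtain ⟨γ, hγ, rfl⟩ := h.velocity v hv
    refine ⟨_, hγ.isometry_comp hM, ?_⟩
    rw [deriv_isometry_comp]
    rfl
  symm := by
    rw [tangentSpace_isometry hM]
    rintro _ ⟨u, hu, rfl⟩ _ ⟨v, hv, rfl⟩
    change transportForm Ψ II (Ψ u) (Ψ v) = transportForm Ψ II (Ψ v) (Ψ u)
    rw [transportForm_apply, transportForm_apply, h.symm u hu v hv]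
  mem_normal := by
    rw [tangentSpace_isometry hM, normalSpace_isometry hM]
    rintro _ ⟨u, hu, rfl⟩ _ ⟨v, hv, rfl⟩
    exact ⟨II u v, h.mem_normal u hu v hv, (transportForm_apply II u v).symm⟩
  curve := by
    rw [normalSpace_isometry hM]
    rintro γ hγ _ ⟨n, hn, rfl⟩
    have h1 := h.curve _ (hγ.symm_comp hM) n hn
    rw [deriv_isometry_comp, deriv_isometry_comp] at h1
    obtain ⟨u, hu⟩ := Ψ.surjective (deriv γ 0)
    obtain ⟨a, ha⟩ := Ψ.surjective (deriv (deriv γ) 0)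
    beta_reduce at h1
    rw [← hu, ← ha, Ψ.symm_apply_apply, Ψ.symm_apply_apply] at h1
    rw [← hu, ← ha]
    change ⟪transportForm Ψ II (Ψ u) (Ψ u), Ψ n⟫_ℝ = ⟪Ψ a, Ψ n⟫_ℝ
    rw [transportForm_apply, Ψ.inner_map_map, Ψ.inner_map_map, h1]

theorem shapeEigenspace_isometry (y : E') (II : E' →ₗ[ℝ] E' →ₗ[ℝ] E') (n : E') (c : ℝ) :
    shapeEigenspace M (Ψ y) (transportForm Ψ II) (Ψ n) c =
      (shapeEigenspace M' y II n c).map (Ψ : E' →ₗ[ℝ] E) := by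
  ext v
  obtain ⟨v, rfl⟩ := Ψ.surjective v
  constructor
  · rintro ⟨h1, h2⟩
    rw [tangentSpace_isometry hM] at h1 h2
    obtain ⟨v', hv', h⟩ := h1
    obtain rfl : v' = v := Ψ.injective h
    refine ⟨v', ⟨hv', fun w hw => ?_⟩, rfl⟩
    have := h2 (Ψ w) ⟨w, hw, rfl⟩
    rwa [transportForm_apply, Ψ.inner_map_map, Ψ.inner_map_map] at this
  · rintro ⟨v', ⟨hv', h2⟩, h⟩
    obtain rfl : v' = v := Ψ.injective h
    refine ⟨?_, ?_⟩
    · rw [tangentSpace_isometry hM]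
      exact ⟨v', hv', rfl⟩
    · rw [tangentSpace_isometry hM]
      rintro _ ⟨w, hw, rfl⟩
      have := h2 w hw
      change ⟪transportForm Ψ II (Ψ _) (Ψ _), Ψ n⟫_ℝ = c * ⟪Ψ _, Ψ _⟫_ℝ
      rwa [transportForm_apply, Ψ.inner_map_map, Ψ.inner_map_map]

theorem ConditionA.isometry {y : E'} (h : ConditionA M' y) : ConditionA M (Ψ y) := by
  obtain ⟨II, hII, K, hK⟩ := h
  refine ⟨transportForm Ψ II, hII.isometry hM, K.map (Ψ : E' →ₗ[ℝ] E), ?_⟩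
  rw [normalSpace_isometry hM]
  rintro _ ⟨n, hn, rfl⟩ hn0
  rw [← hK n hn (fun h0 => hn0 (by rw [h0, map_zero]))]
  exact shapeEigenspace_isometry hM y II n 0

end Transport

section TransportMirror

variable {E E' : Type*} [NormedAddCommGroup E] [InnerProductSpace ℝ E]
  [NormedAddCommGroup E'] [InnerProductSpace ℝ E'] {Ψ : E' ≃ₗᵢ[ℝ] E} {F : E → ℝ} {F' : E' → ℝ}

theorem mirrorMinus_isometry (x n₀ : E') : mirrorMinus (Ψ x) (Ψ n₀) = Ψ (mirrorMinus x n₀) := by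
  simp [mirrorMinus]

theorem mirrorNormal_isometry (x n₀ : E') :
    mirrorNormal (Ψ x) (Ψ n₀) = Ψ (mirrorNormal x n₀) := by
  simp [mirrorNormal]

variable (hF : ∀ z, F (Ψ z) = F' z)
include hF

theorem mem_focalPlus_isometry (z : E') : Ψ z ∈ focalPlus F ↔ z ∈ focalPlus F' := by
  simp [focalPlus, hF]

theorem mem_focalMinus_isometry (z : E') : Ψ z ∈ focalMinus F ↔ z ∈ focalMinus F' := by
  simp [focalMinus, hF]

theorem IsMirrorPair.isometry {x n₀ : E'} (h : IsMirrorPair F' x n₀) :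
    IsMirrorPair F (Ψ x) (Ψ n₀) where
  mem := (mem_focalPlus_isometry hF x).2 h.mem
  conditionA := h.conditionA.isometry (mem_focalPlus_isometry hF)
  normal := by
    rw [normalSpace_isometry (mem_focalPlus_isometry hF)]
    exact ⟨n₀, h.normal, rfl⟩
  unit := by rw [Ψ.norm_map, h.unit]
  mem_sharp := (mem_focalPlus_isometry hF n₀).2 h.mem_sharp
  mem_star := by
    rw [mirrorMinus_isometry]
    exact (mem_focalMinus_isometry hF _).2 h.mem_star

/-- Every identification is composed with Ψ, which leaves its source 𝕆 or Im 𝕆 alone; therefore the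
multiplication does not change. -/
theorem IsMirrorFrame.isometry {x n₀ : E'} {op : Oct →ₗ[ℝ] Oct →ₗ[ℝ] Oct}
    {II IIsharp IIstar : E' →ₗ[ℝ] E' →ₗ[ℝ] E'} {φp φm : Oct →ₗᵢ[ℝ] E'} {ν ν' : ImOct →ₗᵢ[ℝ] E'}
    (h : IsMirrorFrame F' x n₀ op II IIsharp IIstar φp φm ν ν') :
    IsMirrorFrame F (Ψ x) (Ψ n₀) op (transportForm Ψ II) (transportForm Ψ IIsharp)
      (transportForm Ψ IIstar) (Ψ.toLinearIsometry.comp φp) (Ψ.toLinearIsometry.comp φm)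
      (Ψ.toLinearIsometry.comp ν) (Ψ.toLinearIsometry.comp ν') := by
  have hP := mem_focalPlus_isometry hF
  have hN := mem_focalMinus_isometry hF
  have hr : ∀ {G : Type} [NormedAddCommGroup G] [InnerProductSpace ℝ G] (φ : G →ₗᵢ[ℝ] E'),
      LinearMap.range (Ψ.toLinearIsometry.comp φ).toLinearMap =
        (LinearMap.range φ.toLinearMap).map (Ψ : E' →ₗ[ℝ] E) := fun φ =>
    LinearMap.range_comp _ _
  have hs : ∀ y : E', Submodule.span ℝ {Ψ y} = (Submodule.span ℝ {y}).map (Ψ : E' →ₗ[ℝ] E) := by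
    intro y
    rw [Submodule.map_span, Set.image_singleton]
    rfl
  have ho : ∀ y : E', (Submodule.span ℝ {Ψ y})ᗮ =
      ((Submodule.span ℝ {y})ᗮ).map (Ψ : E' →ₗ[ℝ] E) := by
    intro y
    rw [hs]
    exact (Submodule.map_orthogonal_equiv _ Ψ).symm
  have hinf : ∀ A B : Submodule ℝ E', A.map (Ψ : E' →ₗ[ℝ] E) ⊓ B.map (Ψ : E' →ₗ[ℝ] E) =
      (A ⊓ B).map (Ψ : E' →ₗ[ℝ] E) := fun A B => (Submodule.map_inf _ Ψ.injective).symm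
  have hc : ∀ {G : Type} [NormedAddCommGroup G] [InnerProductSpace ℝ G] (φ : G →ₗᵢ[ℝ] E') (u : G),
      Ψ.toLinearIsometry.comp φ u = Ψ (φ u) := fun _ _ => rfl
  constructor
  · exact h.form.isometry hP
  · rw [hr, hr, hr, tangentSpace_isometry hP, h.tangent, Submodule.map_sup, Submodule.map_sup]
  · rw [hr, normalSpace_isometry hP, ho, hinf, h.normal]
  · rw [hr, shapeEigenspace_isometry hP, h.eigen_pos]
  · rw [hr, shapeEigenspace_isometry hP, h.eigen_neg]
  · rw [hr, shapeEigenspace_isometry hP, h.eigen_zero]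
  · intro a y u v
    simp only [hc, ← map_add,
      transportForm_apply, Ψ.inner_map_map]
    exact h.form_eq a y u v
  · exact h.form_sharp.isometry hP
  · rw [hr, hr, hr, tangentSpace_isometry hP, h.tangent_sharp, Submodule.map_sup,
      Submodule.map_sup]
  · rw [hr, normalSpace_isometry hP, ho, hinf, h.normal_sharp]
  · rw [hr, shapeEigenspace_isometry hP, h.eigen_sharp_pos]
  · rw [hr, shapeEigenspace_isometry hP, h.eigen_sharp_neg]
  · rw [hr, shapeEigenspace_isometry hP, h.eigen_sharp_zero]
  · intro a y u v
    simp only [hc, ← map_add,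
      transportForm_apply, Ψ.inner_map_map]
    exact h.form_sharp_eq a y u v
  · rw [mirrorMinus_isometry]
    exact h.form_star.isometry hN
  · rw [hr, hr, hr, mirrorMinus_isometry, tangentSpace_isometry hN, h.tangent_star,
      Submodule.map_sup, Submodule.map_sup]
  · rw [hr, mirrorMinus_isometry, mirrorNormal_isometry, normalSpace_isometry hN, hs,
      h.normal_star, Submodule.map_sup]
  · rw [hr, mirrorMinus_isometry, mirrorNormal_isometry, shapeEigenspace_isometry hN,
      h.eigen_star_pos]
  · rw [hr, mirrorMinus_isometry, mirrorNormal_isometry, shapeEigenspace_isometry hN,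
      h.eigen_star_neg]
  · rw [hr, mirrorMinus_isometry, mirrorNormal_isometry, shapeEigenspace_isometry hN,
      h.eigen_star_zero]
  · intro X Y Z
    simp only [hc, ← map_add,
      transportForm_apply, mirrorNormal_isometry, ← map_smul]
    rw [h.form_star_eq X Y Z]

theorem IsMirrorPointWithMultiplication.isometry {z : E'} {op : Oct →ₗ[ℝ] Oct →ₗ[ℝ] Oct}
    (h : IsMirrorPointWithMultiplication F' z op) :
    IsMirrorPointWithMultiplication F (Ψ z) op := by
  obtain ⟨x, n₀, hxn, rfl, II, IIsharp, IIstar, φp, φm, ν, ν', hframe⟩ := h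
  exact ⟨Ψ x, Ψ n₀, hxn.isometry hF, (mirrorMinus_isometry x n₀).symm, _, _, _, _, _, _, _,
    hframe.isometry hF⟩

end TransportMirror

/-! ### Second-order jets of curves. -/

section Jets

variable {E G H : Type*} [NormedAddCommGroup E] [NormedSpace ℝ E] [NormedAddCommGroup G]
  [NormedSpace ℝ G] [NormedAddCommGroup H] [NormedSpace ℝ H]

/-- `f` is twice differentiable at `0`, with value `a` and derivatives `b` and `c`. -/
def HasTwoJet (f : ℝ → E) (a b c : E) : Prop :=
  ∃ g : ℝ → E, (∀ᶠ t in 𝓝 0, HasDerivAt f (g t) t) ∧ HasDerivAt g c 0 ∧ f 0 = a ∧ g 0 = b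

theorem ContDiffAt.hasTwoJet {f : ℝ → E} (hf : ContDiffAt ℝ ∞ f 0) :
    HasTwoJet f (f 0) (deriv f 0) (deriv (deriv f) 0) := by
  have h2 : ContDiffAt ℝ ((1 : ℕ) + 1) f 0 := by
    have : (((1 : ℕ) : WithTop ℕ∞) + 1) = ((2 : ℕ∞) : WithTop ℕ∞) := by norm_num
    exact hf.of_le (this ▸ by exact_mod_cast le_top)
  have h1 : ∀ᶠ t in 𝓝 0, HasDerivAt f (deriv f t) t := by
    have : ∀ᶠ t in 𝓝 (0 : ℝ), ContDiffAt ℝ 1 f t :=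
      (hf.of_le (by exact_mod_cast le_top)).eventually (by simp)
    filter_upwards [this] with t ht
    exact (ht.differentiableAt (by simp)).hasDerivAt
  refine ⟨deriv f, h1, ?_, rfl, rfl⟩
  have h3 : ContDiffAt ℝ 1 (fderiv ℝ f) 0 := h2.fderiv_right (by norm_num)
  have h4 : DifferentiableAt ℝ (fun t => fderiv ℝ f t 1) 0 :=
    (h3.differentiableAt (by simp)).clm_apply (differentiableAt_const _)
  exact h4.hasDerivAt

/-- Equality near 0 gives equality of first derivatives near 0, hence of second derivatives at 0. An
equation holding along a curve thereby becomes equations for its velocity and acceleration. -/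
theorem HasTwoJet.congr {f f' : ℝ → E} {a b c a' b' c' : E} (h : HasTwoJet f a b c)
    (h' : HasTwoJet f' a' b' c') (hf : ∀ᶠ t in 𝓝 0, f t = f' t) : a = a' ∧ b = b' ∧ c = c' := by
  obtain ⟨g, hg, hc, rfl, rfl⟩ := h
  obtain ⟨g', hg', hc', rfl, rfl⟩ := h'
  have hgg : g =ᶠ[𝓝 0] g' := by
    filter_upwards [hg, hg', hf.eventually_nhds] with t h1 h2 h3
    exact h1.unique (h2.congr_of_eventuallyEq h3)
  exact ⟨hf.self_of_nhds, hgg.self_of_nhds, hc.unique (hc'.congr_of_eventuallyEq hgg)⟩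

theorem hasTwoJet_const (a : E) : HasTwoJet (fun _ => a) a 0 0 :=
  ⟨fun _ => 0, .of_forall fun t => hasDerivAt_const t a, hasDerivAt_const 0 0, rfl, rfl⟩

variable [FiniteDimensional ℝ E] [FiniteDimensional ℝ G]

theorem HasTwoJet.linear (L : E →ₗ[ℝ] H) {f : ℝ → E} {a b c : E} (h : HasTwoJet f a b c) :
    HasTwoJet (fun t => L (f t)) (L a) (L b) (L c) := by
  obtain ⟨g, hg, hc, rfl, rfl⟩ := h
  refine ⟨fun t => L (g t), ?_, L.toContinuousLinearMap.hasFDerivAt.comp_hasDerivAt 0 hc, rfl, rfl⟩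
  filter_upwards [hg] with t ht
  exact L.toContinuousLinearMap.hasFDerivAt.comp_hasDerivAt t ht

theorem HasTwoJet.bilinear (B : E →ₗ[ℝ] G →ₗ[ℝ] H) {f : ℝ → E} {f' : ℝ → G} {a b c : E}
    {a' b' c' : G} (h : HasTwoJet f a b c) (h' : HasTwoJet f' a' b' c') :
    HasTwoJet (fun t => B (f t) (f' t)) (B a a') (B a b' + B b a')
      (B a c' + B b b' + (B b b' + B c a')) := by
  obtain ⟨g, hg, hc, rfl, rfl⟩ := h
  obtain ⟨g', hg', hc', rfl, rfl⟩ := h'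
  refine ⟨fun t => B (f t) (g' t) + B (g t) (f' t), ?_, ?_, rfl, rfl⟩
  · filter_upwards [hg, hg'] with t h1 h2
    exact B.toContinuousBilinearMap.hasDerivAt_of_bilinear (fun _ => h1) (fun _ => h2)
  · exact (B.toContinuousBilinearMap.hasDerivAt_of_bilinear (fun _ => hg.self_of_nhds)
      (fun _ => hc')).add
      (B.toContinuousBilinearMap.hasDerivAt_of_bilinear (fun _ => hc) (fun _ => hg'.self_of_nhds))

end Jets

/-! ### Tangent vectors, normal vectors and radial projection. -/

section Geometry

variable {E : Type*} [NormedAddCommGroup E] [InnerProductSpace ℝ E] {M : Set E} {x : E}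

theorem tangentSpace_eq {T : Submodule ℝ E} (h₁ : ∀ γ, IsCurveIn M x γ → deriv γ 0 ∈ T)
    (h₂ : ∀ v ∈ T, ∃ γ, IsCurveIn M x γ ∧ deriv γ 0 = v) : tangentSpace M x = T := by
  apply le_antisymm
  · rw [tangentSpace, Submodule.span_le]
    rintro _ ⟨γ, hγ, rfl⟩
    exact h₁ γ hγ
  · intro v hv
    exact Submodule.subset_span (h₂ v hv)

theorem mem_normalSpace {n : E} :
    n ∈ normalSpace M x ↔ (∀ v ∈ tangentSpace M x, ⟪v, n⟫_ℝ = 0) ∧ ⟪x, n⟫_ℝ = 0 := by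
  rw [normalSpace, ← Submodule.inf_orthogonal, Submodule.mem_inf, Submodule.mem_orthogonal,
    Submodule.mem_orthogonal_singleton_iff_inner_right]

theorem IsCurveIn.inner_deriv [FiniteDimensional ℝ E] (hM : ∀ z ∈ M, ‖z‖ = 1) {γ : ℝ → E}
    (hγ : IsCurveIn M x γ) : ⟪x, deriv γ 0⟫_ℝ = 0 := by
  have h1 := ContDiffAt.hasTwoJet hγ.smooth
  have h2 := (h1.bilinear (innerₗ E) h1).congr (hasTwoJet_const (1 : ℝ)) (by
    filter_upwards [hγ.mem] with t ht
    rw [innerₗ_apply_apply, real_inner_self_eq_norm_sq, hM _ ht, one_pow])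
  have h3 := h2.2.1
  rw [innerₗ_apply_apply, innerₗ_apply_apply, hγ.base, real_inner_comm] at h3
  rw [real_inner_comm]
  linarith

/-- A curve through a point of the unit sphere whose radial projection lies in `M`. -/
theorem exists_isCurveIn_of_normalize {z : ℝ → E} {v : E} (hz : ContDiffAt ℝ ∞ z 0)
    (hz0 : z 0 = x) (hx : ‖x‖ = 1) (hv : HasDerivAt z v 0) (hxv : ⟪x, v⟫_ℝ = 0)
    (hM : ∀ᶠ t in 𝓝 0, ‖z t‖⁻¹ • z t ∈ M) : ∃ γ, IsCurveIn M x γ ∧ deriv γ 0 = v := by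
  have hne : z 0 ≠ 0 := by
    rw [hz0, ← norm_ne_zero_iff, hx]
    exact one_ne_zero
  have hn : ContDiffAt ℝ ∞ (fun t => ‖z t‖⁻¹) 0 :=
    (hz.norm ℝ hne).inv (norm_ne_zero_iff.2 hne)
  refine ⟨fun t => ‖z t‖⁻¹ • z t, ⟨hn.smul hz, hM, by simp [hz0, hx]⟩, ?_⟩
  -- Since v is orthogonal to x, the norm is stationary at 0, and normalizing does not alter the
  -- velocity.
  have hd : HasDerivAt (fun t => ‖z t‖⁻¹) 0 0 := by
    have h1 : HasDerivAt (fun t => ‖z t‖ ^ 2) 0 0 := by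
      have := hv.norm_sq
      rwa [hz0, hxv, mul_zero] at this
    have h2 := h1.sqrt (by rw [hz0, hx]; norm_num)
    have h3 := h2.inv (by rw [hz0, hx]; norm_num)
    have h4 : (fun t => ‖z t‖⁻¹) = (fun y => √(‖z y‖ ^ 2))⁻¹ := by
      funext t
      simp
    rw [h4]
    simpa using h3
  have := hd.smul hv
  change deriv ((fun t => ‖z t‖⁻¹) • z) 0 = v
  rw [this.deriv, hz0, hx]
  simp

end Geometry

/-! ### Equations of the focal submanifolds. -/

section Polynomial

theorem norm_sq_oct4 (z : Oct4) : ‖z‖ ^ 2 = ‖z 0‖ ^ 2 + ‖z 1‖ ^ 2 + ‖z 2‖ ^ 2 + ‖z 3‖ ^ 2 := by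
  rw [PiLp.norm_sq_eq_of_L2, Fin.sum_univ_four]

theorem inner_oct4 (z w : Oct4) :
    ⟪z, w⟫_ℝ = ⟪z 0, w 0⟫_ℝ + ⟪z 1, w 1⟫_ℝ + ⟪z 2, w 2⟫_ℝ + ⟪z 3, w 3⟫_ℝ := by
  rw [PiLp.inner_apply, Fin.sum_univ_four]

theorem Oct4.ext_iff {z w : Oct4} :
    z = w ↔ z 0 = w 0 ∧ z 1 = w 1 ∧ z 2 = w 2 ∧ z 3 = w 3 := by
  constructor
  · rintro rfl
    simp
  · rintro ⟨h0, h1, h2, h3⟩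
    ext1 i
    fin_cases i <;> assumption

@[simp] theorem Oct4.mk_zero (A X Y B : Oct) : Oct4.mk A X Y B 0 = A := rfl
@[simp] theorem Oct4.mk_one (A X Y B : Oct) : Oct4.mk A X Y B 1 = X := rfl
@[simp] theorem Oct4.mk_two (A X Y B : Oct) : Oct4.mk A X Y B 2 = Y := rfl
@[simp] theorem Oct4.mk_three (A X Y B : Oct) : Oct4.mk A X Y B 3 = B := rfl

/-- Octonion conjugation as a linear map. -/
noncomputable def octConjₗ : Oct →ₗ[ℝ] Oct where
  toFun := octConj
  map_add' := octConj_add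
  map_smul' := octConj_smul

theorem octConjₗ_apply (x : Oct) : octConjₗ x = octConj x := rfl

/-- The component of an element of `ℝ³²`. -/
noncomputable def comp (i : Fin 4) : Oct4 →ₗ[ℝ] Oct := (PiLp.proj 2 (fun _ : Fin 4 => Oct) i : Oct4 →L[ℝ] Oct)

theorem comp_apply (i : Fin 4) (z : Oct4) : comp i z = z i := rfl

/-- The polarization of `|A|² + |Y|²`. -/
noncomputable def formPlus : Oct4 →ₗ[ℝ] Oct4 →ₗ[ℝ] ℝ :=
  (innerₗ Oct).compl₁₂ (comp 0) (comp 0) + (innerₗ Oct).compl₁₂ (comp 2) (comp 2)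

/-- The polarization of `|X|² + |B|²`. -/
noncomputable def formMinus : Oct4 →ₗ[ℝ] Oct4 →ₗ[ℝ] ℝ :=
  (innerₗ Oct).compl₁₂ (comp 1) (comp 1) + (innerₗ Oct).compl₁₂ (comp 3) (comp 3)

/-- The bilinear form `X̄ A + Ȳ ∘ B`. -/
noncomputable def formOct (op : Oct →ₗ[ℝ] Oct →ₗ[ℝ] Oct) : Oct4 →ₗ[ℝ] Oct4 →ₗ[ℝ] Oct :=
  octMul.compl₁₂ (octConjₗ ∘ₗ comp 1) (comp 0) + op.compl₁₂ (octConjₗ ∘ₗ comp 2) (comp 3)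

theorem formPlus_apply (z w : Oct4) : formPlus z w = ⟪z 0, w 0⟫_ℝ + ⟪z 2, w 2⟫_ℝ := rfl

theorem formMinus_apply (z w : Oct4) : formMinus z w = ⟪z 1, w 1⟫_ℝ + ⟪z 3, w 3⟫_ℝ := rfl

theorem formOct_apply (op : Oct →ₗ[ℝ] Oct →ₗ[ℝ] Oct) (z w : Oct4) :
    formOct op z w = octMul (octConj (z 1)) (w 0) + op (octConj (z 2)) (w 3) := rfl

theorem formPlus_self (z : Oct4) : formPlus z z = ‖z 0‖ ^ 2 + ‖z 2‖ ^ 2 := by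
  rw [formPlus_apply, real_inner_self_eq_norm_sq, real_inner_self_eq_norm_sq]

theorem formMinus_self (z : Oct4) : formMinus z z = ‖z 1‖ ^ 2 + ‖z 3‖ ^ 2 := by
  rw [formMinus_apply, real_inner_self_eq_norm_sq, real_inner_self_eq_norm_sq]

theorem formPlus_add_formMinus (z : Oct4) : formPlus z z + formMinus z z = ‖z‖ ^ 2 := by
  rw [formPlus_self, formMinus_self, norm_sq_oct4]
  ring

variable {op : Oct →ₗ[ℝ] Oct →ₗ[ℝ] Oct} (h : IsNormalizedOrthogonalMultiplication op)
include h

/-- Moving factors to their adjoints shows that the eight quadratic forms are, up to the factor -2,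
the coordinates of a single octonion-valued form. Parseval then evaluates the sum of their squares.
-/
theorem inner_cliff (a : Fin 8) (z : Oct4) :
    ⟪cliff op a z, z⟫_ℝ = -2 * ⟪octBasis a, formOct op z z⟫_ℝ := by
  rw [inner_oct4, formOct_apply, inner_add_right]
  simp only [cliff, Oct4.mk_zero, Oct4.mk_one, Oct4.mk_two, Oct4.mk_three, inner_neg_left]
  rw [← octMul_isNormalized.inner_op_eq_left, ← h.inner_op_eq_left]
  have h1 := octMul_isNormalized.inner_op_eq_right (z 1) (octBasis a) (z 0)
  have h2 := h.inner_op_eq_right (z 2) (octBasis a) (z 3)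
  rw [real_inner_comm (z 1) (octMul _ _), real_inner_comm (z 2) (op _ _)]
  linarith

theorem fkmPolynomial_eq (z : Oct4) : fkmPolynomial op z =
    -(‖z‖ ^ 2) ^ 2 +
      2 * ((formPlus z z - formMinus z z) ^ 2 + 4 * ‖formOct op z z‖ ^ 2) := by
  have h1 : ⟪cliffNeg z, z⟫_ℝ = formPlus z z - formMinus z z := by
    rw [inner_oct4, formPlus_apply, formMinus_apply]
    simp only [cliffNeg, Oct4.mk_zero, Oct4.mk_one, Oct4.mk_two, Oct4.mk_three, inner_neg_left]
    ring
  have h2 : ∑ a, ⟪cliff op a z, z⟫_ℝ ^ 2 = 4 * ‖formOct op z z‖ ^ 2 := by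
    simp only [inner_cliff h, mul_pow]
    rw [← Finset.mul_sum, sum_inner_octBasis_sq]
    norm_num
  rw [fkmPolynomial, h1, h2]
  ring

/-- With p + m = 1 on the sphere, F = 1 reads (p - m)² + 4|r|² = (p + m)². -/
theorem mem_focalPlus_iff (z : Oct4) : z ∈ focalPlus (fkmPolynomial op) ↔
    ‖z‖ = 1 ∧ ‖formOct op z z‖ ^ 2 = formPlus z z * formMinus z z := by
  rw [focalPlus, Set.mem_ofPred_eq, and_congr_right_iff]
  intro hz
  have h1 := formPlus_add_formMinus z
  rw [fkmPolynomial_eq h, hz]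
  rw [hz] at h1
  have h2 : formMinus z z = 1 - formPlus z z := by linarith
  rw [h2]
  constructor <;> intro h3 <;> linarith

theorem mem_focalMinus_iff (z : Oct4) : z ∈ focalMinus (fkmPolynomial op) ↔
    ‖z‖ = 1 ∧ formOct op z z = 0 ∧ formPlus z z = formMinus z z := by
  rw [focalMinus, Set.mem_ofPred_eq, and_congr_right_iff]
  intro hz
  rw [fkmPolynomial_eq h, hz]
  constructor
  · intro h3
    have h4 := sq_nonneg (formPlus z z - formMinus z z)
    have h5 := sq_nonneg ‖formOct op z z‖
    constructor
    · have : ‖formOct op z z‖ ^ 2 = 0 := by linarith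
      simpa using this
    · have : (formPlus z z - formMinus z z) ^ 2 = 0 := by linarith
      exact sub_eq_zero.1 (by simpa using this)
  · rintro ⟨h1, h2⟩
    rw [h1, h2]
    simp

/-- The equation is homogeneous, so explicit curves need only satisfy it before being projected to
the sphere. -/
theorem normalize_mem_focalPlus {z : Oct4} (hz : z ≠ 0)
    (h1 : ‖formOct op z z‖ ^ 2 = formPlus z z * formMinus z z) :
    ‖z‖⁻¹ • z ∈ focalPlus (fkmPolynomial op) := by
  rw [mem_focalPlus_iff h]
  refine ⟨norm_smul_inv_norm hz, ?_⟩
  simp only [map_smul, LinearMap.smul_apply, norm_smul, smul_eq_mul, norm_inv, norm_norm, mul_pow, h1]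
  ring

theorem normalize_mem_focalMinus {z : Oct4} (hz : z ≠ 0) (h1 : formOct op z z = 0)
    (h2 : formPlus z z = formMinus z z) : ‖z‖⁻¹ • z ∈ focalMinus (fkmPolynomial op) := by
  rw [mem_focalMinus_iff h]
  refine ⟨norm_smul_inv_norm hz, ?_, ?_⟩
  · simp only [map_smul, LinearMap.smul_apply, h1, smul_zero]
  · simp only [map_smul, LinearMap.smul_apply, h2]

theorem inner_formOct (z : Oct4) (e : Oct) :
    ⟪e, formOct op z z⟫_ℝ = ⟪octMul (z 1) e, z 0⟫_ℝ + ⟪op (z 2) e, z 3⟫_ℝ := by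
  rw [formOct_apply, inner_add_right, octMul_isNormalized.inner_op_eq_left, h.inner_op_eq_left]

/-- The points of `M₊` are fixed by an element of the Clifford sphere; `X`-component. -/
theorem focalPlus_eq_one {z : Oct4} (hz : z ∈ focalPlus (fkmPolynomial op)) :
    formPlus z z • z 1 = octMul (z 0) (octConj (formOct op z z)) := by
  obtain ⟨-, h1⟩ := (mem_focalPlus_iff h z).1 hz
  set r := formOct op z z with hr
  have h2 : ⟪z 1, octMul (z 0) (octConj r)⟫_ℝ + ⟪z 3, op (z 2) r⟫_ℝ = ‖r‖ ^ 2 := by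
    rw [← octMul_isNormalized.inner_op_eq_right, real_inner_comm (op _ _), ← inner_formOct h,
      ← hr, real_inner_self_eq_norm_sq]
  -- Equality in Cauchy–Schwarz: only the sum of the two cross terms is known, so both defects are
  -- expanded together, and their squared norms add up to zero.
  have h3 : ‖formPlus z z • z 1 - octMul (z 0) (octConj r)‖ ^ 2 +
      ‖formPlus z z • z 3 - op (z 2) r‖ ^ 2 = 0 := by
    rw [norm_sub_sq_real, norm_sub_sq_real, real_inner_smul_left, real_inner_smul_left,
      octMul_isNormalized.norm_op, h.norm_op, norm_octConj, norm_smul, norm_smul, mul_pow, mul_pow,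
      mul_pow, mul_pow, Real.norm_eq_abs, sq_abs]
    have e1 := formPlus_self z
    have e2 := formMinus_self z
    generalize formPlus z z = u at *
    generalize formMinus z z = l at *
    have e3 : ‖z 3‖ ^ 2 = l - ‖z 1‖ ^ 2 := by linarith
    have e4 : ‖z 2‖ ^ 2 = u - ‖z 0‖ ^ 2 := by linarith
    have e5 : ⟪z 3, op (z 2) r⟫_ℝ = u * l - ⟪z 1, octMul (z 0) (octConj r)⟫_ℝ := by linarith
    rw [e3, e4, e5, h1]
    ring
  have h4 : ‖formPlus z z • z 1 - octMul (z 0) (octConj r)‖ ^ 2 = 0 := by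
    have := sq_nonneg ‖formPlus z z • z 1 - octMul (z 0) (octConj r)‖
    have := sq_nonneg ‖formPlus z z • z 3 - op (z 2) r‖
    linarith
  exact sub_eq_zero.1 (by simpa using h4)

/-- The points of `M₊` are fixed by an element of the Clifford sphere; `Y`-component. -/
theorem focalPlus_eq_two {z : Oct4} (hz : z ∈ focalPlus (fkmPolynomial op)) :
    formMinus z z • z 2 = op (z 3) (octConj (formOct op z z)) := by
  obtain ⟨-, h1⟩ := (mem_focalPlus_iff h z).1 hz
  set r := formOct op z z with hr
  have h2 : ⟪z 2, op (z 3) (octConj r)⟫_ℝ + ⟪z 0, octMul (z 1) r⟫_ℝ = ‖r‖ ^ 2 := by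
    rw [← h.inner_op_eq_right, real_inner_comm (octMul _ _), add_comm, ← inner_formOct h,
      ← hr, real_inner_self_eq_norm_sq]
  -- The same equality case with the roles of p and m exchanged.
  have h3 : ‖formMinus z z • z 2 - op (z 3) (octConj r)‖ ^ 2 +
      ‖formMinus z z • z 0 - octMul (z 1) r‖ ^ 2 = 0 := by
    rw [norm_sub_sq_real, norm_sub_sq_real, real_inner_smul_left, real_inner_smul_left,
      octMul_isNormalized.norm_op, h.norm_op, norm_octConj, norm_smul, norm_smul, mul_pow, mul_pow,
      mul_pow, mul_pow, Real.norm_eq_abs, sq_abs]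
    have e1 := formPlus_self z
    have e2 := formMinus_self z
    generalize formPlus z z = u at *
    generalize formMinus z z = l at *
    have e3 : ‖z 3‖ ^ 2 = l - ‖z 1‖ ^ 2 := by linarith
    have e4 : ‖z 2‖ ^ 2 = u - ‖z 0‖ ^ 2 := by linarith
    have e5 : ⟪z 0, octMul (z 1) r⟫_ℝ = u * l - ⟪z 2, op (z 3) (octConj r)⟫_ℝ := by linarith
    rw [e3, e4, e5, h1]
    ring
  have h4 : ‖formMinus z z • z 2 - op (z 3) (octConj r)‖ ^ 2 = 0 := by
    have := sq_nonneg ‖formMinus z z • z 2 - op (z 3) (octConj r)‖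
    have := sq_nonneg ‖formMinus z z • z 0 - octMul (z 1) r‖
    linarith
  exact sub_eq_zero.1 (by simpa using h4)

end Polynomial

/-! ### Base points, frames and the candidate tangent spaces and forms. -/

theorem octConj_zero : octConj 0 = 0 := octConjₗ.map_zero

theorem sqrt_two_inv_mul_self : (√2)⁻¹ * (√2)⁻¹ = (2 : ℝ)⁻¹ := by
  rw [← mul_inv, Real.mul_self_sqrt zero_le_two]

theorem sqrt_two_mul_inv : √2 * (√2)⁻¹ = (1 : ℝ) :=
  mul_inv_cancel₀ (Real.sqrt_ne_zero'.2 zero_lt_two)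

theorem sqrt_two_inv_mul : (√2)⁻¹ * √2 = (1 : ℝ) :=
  inv_mul_cancel₀ (Real.sqrt_ne_zero'.2 zero_lt_two)

/-- The inclusion of the second component of `ℝ³²`. -/
def inclOne : Oct →ₗ[ℝ] Oct4 where
  toFun X := Oct4.mk 0 X 0 0
  map_add' X X' := by rw [Oct4.ext_iff]; simp
  map_smul' c X := by rw [Oct4.ext_iff]; simp

/-- The inclusion of the third component of `ℝ³²`. -/
def inclTwo : Oct →ₗ[ℝ] Oct4 where
  toFun Y := Oct4.mk 0 0 Y 0
  map_add' X X' := by rw [Oct4.ext_iff]; simp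
  map_smul' c X := by rw [Oct4.ext_iff]; simp

theorem inclOne_apply (X : Oct) : inclOne X = Oct4.mk 0 X 0 0 := rfl

theorem inclTwo_apply (Y : Oct) : inclTwo Y = Oct4.mk 0 0 Y 0 := rfl

/-- The point `(0, 0, -e₀, 0)` of `M₊`. -/
noncomputable def basePoint : Oct4 := Oct4.mk 0 0 (-octOne) 0

/-- The unit normal vector `(0, e₀, 0, 0)` at `basePoint`. -/
noncomputable def baseNormal : Oct4 := Oct4.mk 0 octOne 0 0

/-- The identification `u ↦ (u, 0, 0, -u) / √2` of `𝕆` with `V₊`. -/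
noncomputable def framePos : Oct →ₗᵢ[ℝ] Oct4 where
  toFun u := Oct4.mk ((√2)⁻¹ • u) 0 0 (-((√2)⁻¹ • u))
  map_add' u u' := by rw [Oct4.ext_iff]; simp [add_comm]
  map_smul' c u := by rw [Oct4.ext_iff]; simp [smul_comm c]
  norm_map' u := by
    rw [← sq_eq_sq₀ (norm_nonneg _) (norm_nonneg _), norm_sq_oct4]
    simp [norm_smul, mul_pow]
    ring

/-- The identification `v ↦ -(v, 0, 0, v) / √2` of `𝕆` with `V₋`. -/
noncomputable def frameNeg : Oct →ₗᵢ[ℝ] Oct4 where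
  toFun u := Oct4.mk (-((√2)⁻¹ • u)) 0 0 (-((√2)⁻¹ • u))
  map_add' u u' := by rw [Oct4.ext_iff]; simp [add_comm]
  map_smul' c u := by rw [Oct4.ext_iff]; simp [smul_comm c]
  norm_map' u := by
    rw [← sq_eq_sq₀ (norm_nonneg _) (norm_nonneg _), norm_sq_oct4]
    simp [norm_smul, mul_pow]
    ring

/-- The identification `a ↦ (0, a, 0, 0)` of `Im 𝕆` with the normal vectors at `basePoint`
orthogonal to `baseNormal`. -/
noncomputable def frameNormal : ImOct →ₗᵢ[ℝ] Oct4 where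
  toLinearMap := inclOne ∘ₗ ImOct.subtype
  norm_map' u := by
    rw [← sq_eq_sq₀ (norm_nonneg _) (norm_nonneg _), norm_sq_oct4]
    simp [inclOne_apply]

/-- The identification `y ↦ (0, 0, y, 0)` of `Im 𝕆` with `V₀`. -/
noncomputable def frameKer : ImOct →ₗᵢ[ℝ] Oct4 where
  toLinearMap := inclTwo ∘ₗ ImOct.subtype
  norm_map' u := by
    rw [← sq_eq_sq₀ (norm_nonneg _) (norm_nonneg _), norm_sq_oct4]
    simp [inclTwo_apply]

theorem framePos_apply (u : Oct) :
    framePos u = Oct4.mk ((√2)⁻¹ • u) 0 0 (-((√2)⁻¹ • u)) := rfl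

theorem frameNeg_apply (u : Oct) :
    frameNeg u = Oct4.mk (-((√2)⁻¹ • u)) 0 0 (-((√2)⁻¹ • u)) := rfl

theorem frameNormal_apply (a : ImOct) : frameNormal a = Oct4.mk 0 a 0 0 := rfl

theorem frameKer_apply (a : ImOct) : frameKer a = Oct4.mk 0 0 a 0 := rfl

theorem mem_range_framePos {z : Oct4} : z ∈ LinearMap.range framePos.toLinearMap ↔
    z 1 = 0 ∧ z 2 = 0 ∧ z 3 = -z 0 := by
  constructor
  · rintro ⟨u, rfl⟩
    exact ⟨rfl, rfl, rfl⟩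
  · rintro ⟨h1, h2, h3⟩
    refine ⟨√2 • z 0, ?_⟩
    change framePos _ = _
    rw [framePos_apply, smul_smul, sqrt_two_inv_mul, one_smul, Oct4.ext_iff]
    exact ⟨rfl, h1.symm, h2.symm, h3.symm⟩

theorem mem_range_frameNeg {z : Oct4} : z ∈ LinearMap.range frameNeg.toLinearMap ↔
    z 1 = 0 ∧ z 2 = 0 ∧ z 3 = z 0 := by
  constructor
  · rintro ⟨u, rfl⟩
    exact ⟨rfl, rfl, rfl⟩
  · rintro ⟨h1, h2, h3⟩
    refine ⟨-(√2 • z 0), ?_⟩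
    change frameNeg _ = _
    rw [frameNeg_apply, smul_neg, smul_smul, sqrt_two_inv_mul, one_smul, neg_neg, Oct4.ext_iff]
    exact ⟨rfl, h1.symm, h2.symm, h3.symm⟩

theorem mem_range_frameNormal {z : Oct4} : z ∈ LinearMap.range frameNormal.toLinearMap ↔
    z 0 = 0 ∧ z 1 ∈ ImOct ∧ z 2 = 0 ∧ z 3 = 0 := by
  constructor
  · rintro ⟨u, rfl⟩
    exact ⟨rfl, u.2, rfl, rfl⟩
  · rintro ⟨h0, h1, h2, h3⟩
    refine ⟨⟨z 1, h1⟩, ?_⟩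
    change frameNormal _ = _
    rw [frameNormal_apply, Oct4.ext_iff]
    exact ⟨h0.symm, rfl, h2.symm, h3.symm⟩

theorem mem_range_frameKer {z : Oct4} : z ∈ LinearMap.range frameKer.toLinearMap ↔
    z 0 = 0 ∧ z 1 = 0 ∧ z 2 ∈ ImOct ∧ z 3 = 0 := by
  constructor
  · rintro ⟨u, rfl⟩
    exact ⟨rfl, rfl, u.2, rfl⟩
  · rintro ⟨h0, h1, h2, h3⟩
    refine ⟨⟨z 2, h2⟩, ?_⟩
    change frameKer _ = _
    rw [frameKer_apply, Oct4.ext_iff]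
    exact ⟨h0.symm, h1.symm, rfl, h3.symm⟩

/-- The tangent space of `M₊` at `basePoint`. -/
noncomputable def baseTangent : Submodule ℝ Oct4 :=
  LinearMap.range framePos.toLinearMap ⊔ LinearMap.range frameNeg.toLinearMap ⊔
    LinearMap.range frameKer.toLinearMap

/-- The tangent space of `M₊` at `baseNormal`. -/
noncomputable def sharpTangent : Submodule ℝ Oct4 :=
  LinearMap.range framePos.toLinearMap ⊔ LinearMap.range frameNeg.toLinearMap ⊔
    LinearMap.range frameNormal.toLinearMap

/-- The tangent space of `M₋` at the mirror point. -/
noncomputable def starTangent : Submodule ℝ Oct4 :=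
  LinearMap.range frameNormal.toLinearMap ⊔ LinearMap.range frameKer.toLinearMap ⊔
    LinearMap.range frameNeg.toLinearMap

theorem half_add_half_sub (a b : Oct) :
    (√2)⁻¹ • (√2)⁻¹ • (a - b) + (√2)⁻¹ • (√2)⁻¹ • (a + b) = a := by
  rw [smul_smul, smul_smul, sqrt_two_inv_mul_self]
  module

theorem half_add_half_sub' (a b : Oct) :
    -((√2)⁻¹ • (√2)⁻¹ • (a - b)) + (√2)⁻¹ • (√2)⁻¹ • (a + b) = b := by
  rw [smul_smul, smul_smul, sqrt_two_inv_mul_self]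
  module

theorem mem_baseTangent {z : Oct4} : z ∈ baseTangent ↔ z 1 = 0 ∧ z 2 ∈ ImOct := by
  simp only [baseTangent, Submodule.mem_sup]
  constructor
  · rintro ⟨_, ⟨_, ⟨u, rfl⟩, _, ⟨v, rfl⟩, rfl⟩, _, ⟨y, rfl⟩, rfl⟩
    constructor
    · simp [framePos_apply, frameNeg_apply, frameKer_apply]
    · simp [framePos_apply, frameNeg_apply, frameKer_apply]
  · rintro ⟨h1, h2⟩
    -- V₊ and V₋ are the antidiagonal and diagonal of the first and last components; these are the
    -- corresponding rotated coordinates.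
    refine ⟨_, ⟨_, ⟨(√2)⁻¹ • (z 0 - z 3), rfl⟩, _, ⟨-((√2)⁻¹ • (z 0 + z 3)), rfl⟩, rfl⟩, _,
      ⟨⟨z 2, h2⟩, rfl⟩, ?_⟩
    rw [Oct4.ext_iff]
    simp only [LinearIsometry.coe_toLinearMap, framePos_apply, frameNeg_apply, frameKer_apply,
      PiLp.add_apply, Oct4.mk_zero, Oct4.mk_one, Oct4.mk_two, Oct4.mk_three, smul_neg, neg_neg,
      half_add_half_sub, half_add_half_sub', add_zero, zero_add, h1, and_self]

theorem mem_sharpTangent {z : Oct4} : z ∈ sharpTangent ↔ z 1 ∈ ImOct ∧ z 2 = 0 := by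
  simp only [sharpTangent, Submodule.mem_sup]
  constructor
  · rintro ⟨_, ⟨_, ⟨u, rfl⟩, _, ⟨v, rfl⟩, rfl⟩, _, ⟨y, rfl⟩, rfl⟩
    constructor
    · simp [framePos_apply, frameNeg_apply, frameNormal_apply]
    · simp [framePos_apply, frameNeg_apply, frameNormal_apply]
  · rintro ⟨h1, h2⟩
    refine ⟨_, ⟨_, ⟨(√2)⁻¹ • (z 0 - z 3), rfl⟩, _, ⟨-((√2)⁻¹ • (z 0 + z 3)), rfl⟩, rfl⟩, _,
      ⟨⟨z 1, h1⟩, rfl⟩, ?_⟩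
    rw [Oct4.ext_iff]
    simp only [LinearIsometry.coe_toLinearMap, framePos_apply, frameNeg_apply, frameNormal_apply,
      PiLp.add_apply, Oct4.mk_zero, Oct4.mk_one, Oct4.mk_two, Oct4.mk_three, smul_neg, neg_neg,
      half_add_half_sub, half_add_half_sub', add_zero, zero_add, h2, and_self]

theorem mem_starTangent {z : Oct4} :
    z ∈ starTangent ↔ z 0 = z 3 ∧ z 1 ∈ ImOct ∧ z 2 ∈ ImOct := by
  simp only [starTangent, Submodule.mem_sup]
  constructor
  · rintro ⟨_, ⟨_, ⟨u, rfl⟩, _, ⟨v, rfl⟩, rfl⟩, _, ⟨y, rfl⟩, rfl⟩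
    refine ⟨?_, ?_, ?_⟩ <;> simp [frameNormal_apply, frameNeg_apply, frameKer_apply]
  · rintro ⟨h0, h1, h2⟩
    refine ⟨_, ⟨_, ⟨⟨z 1, h1⟩, rfl⟩, _, ⟨⟨z 2, h2⟩, rfl⟩, rfl⟩, _, ⟨-(√2 • z 0), rfl⟩, ?_⟩
    rw [Oct4.ext_iff]
    simp only [LinearIsometry.coe_toLinearMap, frameNeg_apply, frameNormal_apply, frameKer_apply,
      PiLp.add_apply, Oct4.mk_zero, Oct4.mk_one, Oct4.mk_two, Oct4.mk_three, smul_neg, neg_neg,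
      smul_smul, sqrt_two_inv_mul, one_smul, add_zero, zero_add, h0, and_self]

/-- The second fundamental form of `M₊` at `basePoint`. -/
noncomputable def baseForm : Oct4 →ₗ[ℝ] Oct4 →ₗ[ℝ] Oct4 :=
  -((octMul.compl₁₂ (comp 0) (octConjₗ ∘ₗ comp 3) +
    (octMul.compl₁₂ (comp 0) (octConjₗ ∘ₗ comp 3)).flip).compr₂ inclOne)

/-- The second fundamental form of `M₊` at `baseNormal`. -/
noncomputable def sharpForm (op : Oct →ₗ[ℝ] Oct →ₗ[ℝ] Oct) : Oct4 →ₗ[ℝ] Oct4 →ₗ[ℝ] Oct4 :=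
  (op.compl₁₂ (comp 3) (octConjₗ ∘ₗ comp 0) +
    (op.compl₁₂ (comp 3) (octConjₗ ∘ₗ comp 0)).flip).compr₂ inclTwo

/-- The second fundamental form of `M₋` at the mirror point. -/
noncomputable def starForm (op : Oct →ₗ[ℝ] Oct →ₗ[ℝ] Oct) : Oct4 →ₗ[ℝ] Oct4 →ₗ[ℝ] Oct4 :=
  ((innerₗ Oct).compl₁₂ (comp 1) (comp 1) - (innerₗ Oct).compl₁₂ (comp 2) (comp 2)).compr₂
    (LinearMap.toSpanSingleton ℝ Oct4 (mirrorNormal basePoint baseNormal)) +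
  ((octMul.compl₁₂ (comp 1) (comp 0) + op.compl₁₂ (comp 2) (comp 0)) +
    (octMul.compl₁₂ (comp 1) (comp 0) + op.compl₁₂ (comp 2) (comp 0)).flip).compr₂
    framePos.toLinearMap

theorem baseForm_apply (v w : Oct4) : baseForm v w = -Oct4.mk 0
    (octMul (v 0) (octConj (w 3)) + octMul (w 0) (octConj (v 3))) 0 0 := rfl

theorem sharpForm_apply (op : Oct →ₗ[ℝ] Oct →ₗ[ℝ] Oct) (v w : Oct4) :
    sharpForm op v w = Oct4.mk 0 0 (op (v 3) (octConj (w 0)) + op (w 3) (octConj (v 0))) 0 := rfl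

theorem starForm_apply (op : Oct →ₗ[ℝ] Oct →ₗ[ℝ] Oct) (v w : Oct4) : starForm op v w =
    (⟪v 1, w 1⟫_ℝ - ⟪v 2, w 2⟫_ℝ) • mirrorNormal basePoint baseNormal +
      framePos (octMul (v 1) (w 0) + op (v 2) (w 0) + (octMul (w 1) (v 0) + op (w 2) (v 0))) :=
  rfl

section Points

theorem norm_basePoint : ‖basePoint‖ = 1 := by
  rw [← sq_eq_sq₀ (norm_nonneg _) zero_le_one, norm_sq_oct4]
  simp [basePoint, norm_octOne]

theorem norm_baseNormal : ‖baseNormal‖ = 1 := by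
  rw [← sq_eq_sq₀ (norm_nonneg _) zero_le_one, norm_sq_oct4]
  simp [baseNormal, norm_octOne]

theorem mirrorMinus_eq : mirrorMinus basePoint baseNormal =
    Oct4.mk 0 ((√2)⁻¹ • octOne) (-((√2)⁻¹ • octOne)) 0 := by
  rw [mirrorMinus, Oct4.ext_iff]
  simp [basePoint, baseNormal]

theorem mirrorNormal_eq : mirrorNormal basePoint baseNormal =
    Oct4.mk 0 (-((√2)⁻¹ • octOne)) (-((√2)⁻¹ • octOne)) 0 := by
  rw [mirrorNormal, Oct4.ext_iff]
  simp [basePoint, baseNormal]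

theorem norm_mirrorMinus : ‖mirrorMinus basePoint baseNormal‖ = 1 := by
  rw [← sq_eq_sq₀ (norm_nonneg _) zero_le_one, norm_sq_oct4, mirrorMinus_eq]
  simp [norm_octOne, norm_smul]
  norm_num

theorem norm_mirrorNormal : ‖mirrorNormal basePoint baseNormal‖ = 1 := by
  rw [← sq_eq_sq₀ (norm_nonneg _) zero_le_one, norm_sq_oct4, mirrorNormal_eq]
  simp [norm_octOne, norm_smul]
  norm_num

variable {op : Oct →ₗ[ℝ] Oct →ₗ[ℝ] Oct} (h : IsNormalizedOrthogonalMultiplication op)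
include h

theorem basePoint_mem : basePoint ∈ focalPlus (fkmPolynomial op) := by
  rw [mem_focalPlus_iff h]
  exact ⟨norm_basePoint, by simp [formOct_apply, formPlus_apply, formMinus_apply, basePoint]⟩

theorem baseNormal_mem : baseNormal ∈ focalPlus (fkmPolynomial op) := by
  rw [mem_focalPlus_iff h]
  exact ⟨norm_baseNormal, by simp [formOct_apply, formPlus_apply, formMinus_apply, baseNormal]⟩

theorem mirrorMinus_mem :
    mirrorMinus basePoint baseNormal ∈ focalMinus (fkmPolynomial op) := by
  rw [mem_focalMinus_iff h]
  refine ⟨norm_mirrorMinus, ?_, ?_⟩ <;>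
  rw [mirrorMinus_eq] <;> simp [formOct_apply, formPlus_apply, formMinus_apply]

end Points

theorem inner_octOne_of_mem {x : Oct} (hx : x ∈ ImOct) : ⟪octOne, x⟫_ℝ = 0 := by
  rw [real_inner_comm, mem_ImOct.1 hx]

/-! ### Curves realizing every tangent vector. -/

section Curves

theorem contDiff_oct4_mk {f₀ f₁ f₂ f₃ : ℝ → Oct} (h₀ : ContDiff ℝ ∞ f₀) (h₁ : ContDiff ℝ ∞ f₁)
    (h₂ : ContDiff ℝ ∞ f₂) (h₃ : ContDiff ℝ ∞ f₃) :
    ContDiff ℝ ∞ (fun t => Oct4.mk (f₀ t) (f₁ t) (f₂ t) (f₃ t)) := by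
  rw [contDiff_piLp]
  intro i
  fin_cases i <;> assumption

/-- Writing the curve as x + tG(t) makes the initial velocity the value G(0), so no derivative of
the explicit formulas has to be computed. -/
theorem exists_isCurveIn_of_smul {E : Type*} [NormedAddCommGroup E] [InnerProductSpace ℝ E]
    {M : Set E} {x v : E} {G : ℝ → E} (hG : ContDiff ℝ ∞ G) (hx : ‖x‖ = 1) (hv : G 0 = v)
    (hxv : ⟪x, v⟫_ℝ = 0) (hM : ∀ t, x + t • G t ≠ 0 → ‖x + t • G t‖⁻¹ • (x + t • G t) ∈ M) :
    ∃ γ, IsCurveIn M x γ ∧ deriv γ 0 = v := by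
  have hz : ContDiff ℝ ∞ (fun t : ℝ => x + t • G t) :=
    contDiff_const.add (contDiff_id.smul hG)
  have hd : HasDerivAt (fun t : ℝ => x + t • G t) v 0 := by
    have h1 := ((hasDerivAt_id (0 : ℝ)).smul
      (hG.differentiable (by simp) 0).hasDerivAt).const_add x
    simpa [hv] using h1
  refine exists_isCurveIn_of_normalize hz.contDiffAt (by simp) hx hd hxv ?_
  have hc : ∀ᶠ t in 𝓝 (0 : ℝ), x + t • G t ≠ 0 := by
    refine hz.continuous.continuousAt.eventually_ne ?_
    rw [zero_smul, add_zero, ← norm_ne_zero_iff, hx]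
    exact one_ne_zero
  exact hc.mono fun t ht => hM t ht

variable {op : Oct →ₗ[ℝ] Oct →ₗ[ℝ] Oct} (h : IsNormalizedOrthogonalMultiplication op)
include h

theorem IsNormalizedOrthogonalMultiplication.conj_op_op (x y : Oct) :
    op (octConj (op x y)) x = ‖x‖ ^ 2 • octConj y := by
  refine ext_inner_left ℝ fun e => ?_
  rw [← h.inner_op_eq_left, h.inner_op_eq_right, h.inner_op_left, real_inner_smul_right,
    ← inner_octConj_octConj, octConj_octConj, real_inner_comm]

/-- Here r = -pq and m = p|q|², so equality holds in |r|² ≤ pm. These points solve the equality case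
with A, Y, q free. -/
theorem focalPlus_param_base (A Y q : Oct) {z : Oct4}
    (hz : z = Oct4.mk A (-octMul A (octConj q)) Y (-op Y q)) :
    ‖formOct op z z‖ ^ 2 = formPlus z z * formMinus z z := by
  subst hz
  have h1 : op (octConj Y) (op Y q) = ‖Y‖ ^ 2 • q := h.op_conj_op Y q
  rw [formPlus_self, formMinus_self, formOct_apply]
  simp only [Oct4.mk_zero, Oct4.mk_one, Oct4.mk_two, Oct4.mk_three, octConj_neg, map_neg,
    LinearMap.neg_apply, octMul_isNormalized.conj_op_op, h1, octConj_octConj, norm_neg,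
    octMul_isNormalized.norm_op, h.norm_op, norm_octConj]
  rw [← neg_add, norm_neg, ← add_smul, norm_smul, Real.norm_of_nonneg (by positivity)]
  ring

/-- Here r = -mq and p = m|q|²; now X, B and q are free. -/
theorem focalPlus_param_sharp (X B q : Oct) {z : Oct4}
    (hz : z = Oct4.mk (-octMul X q) X (-op B (octConj q)) B) :
    ‖formOct op z z‖ ^ 2 = formPlus z z * formMinus z z := by
  subst hz
  have h1 : octMul (octConj X) (octMul X q) = ‖X‖ ^ 2 • q := octMul_isNormalized.op_conj_op X q
  rw [formPlus_self, formMinus_self, formOct_apply]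
  simp only [Oct4.mk_zero, Oct4.mk_one, Oct4.mk_two, Oct4.mk_three, octConj_neg, map_neg,
    LinearMap.neg_apply, h.conj_op_op, h1, octConj_octConj, norm_neg,
    octMul_isNormalized.norm_op, h.norm_op, norm_octConj]
  rw [← neg_add, norm_neg, ← add_smul, norm_smul, Real.norm_of_nonneg (by positivity)]
  ring

/-- The first component solves r = 0 when the last one is |X|²C; the condition |X| = |Y| then makes
p = m. -/
theorem focalMinus_param (X Y C : Oct) (hXY : ‖X‖ = ‖Y‖) {z : Oct4}
    (hz : z = Oct4.mk (-octMul X (op (octConj Y) C)) X Y (‖X‖ ^ 2 • C)) :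
    formOct op z z = 0 ∧ formPlus z z = formMinus z z := by
  subst hz
  constructor
  · rw [formOct_apply]
    simp [octMul_isNormalized.op_conj_op]
  · rw [formPlus_self, formMinus_self]
    simp only [Oct4.mk_zero, Oct4.mk_one, Oct4.mk_two, Oct4.mk_three, norm_neg,
      octMul_isNormalized.norm_op, h.norm_op, norm_octConj, norm_smul, norm_pow, norm_norm, hXY]
    ring

theorem exists_isCurveIn_base {v : Oct4} (hv : v ∈ baseTangent) :
    ∃ γ, IsCurveIn (focalPlus (fkmPolynomial op)) basePoint γ ∧ deriv γ 0 = v := by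
  obtain ⟨h1, h2⟩ := mem_baseTangent.1 hv
  -- The coefficient of t² in the parametrization with A = t v₀, Y = -e₀ + t v₂, q = t v₃.
  let u : Oct4 := Oct4.mk 0 (-octMul (v 0) (octConj (v 3))) 0 (-op (v 2) (v 3))
  refine exists_isCurveIn_of_smul (G := fun t => v + t • u) (by fun_prop) norm_basePoint
    (by simp) ?_ fun t ht => normalize_mem_focalPlus h ht ?_
  · rw [inner_oct4]
    simp [basePoint, inner_octOne_of_mem h2, -WithLp.prod_inner_apply]
  · refine focalPlus_param_base h (t • v 0) (-octOne + t • v 2) (t • v 3) ?_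
    rw [Oct4.ext_iff]
    simp [basePoint, u, h1, octConj_smul, h.one_op, add_comm]

theorem exists_isCurveIn_sharp {v : Oct4} (hv : v ∈ sharpTangent) :
    ∃ γ, IsCurveIn (focalPlus (fkmPolynomial op)) baseNormal γ ∧ deriv γ 0 = v := by
  obtain ⟨h1, h2⟩ := mem_sharpTangent.1 hv
  -- The coefficient of t² for X = e₀ + t v₁, B = t v₃, q = -t v₀.
  let u : Oct4 := Oct4.mk (octMul (v 1) (v 0)) 0 (op (v 3) (octConj (v 0))) 0
  refine exists_isCurveIn_of_smul (G := fun t => v + t • u) (by fun_prop) norm_baseNormal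
    (by simp) ?_ fun t ht => normalize_mem_focalPlus h ht ?_
  · rw [inner_oct4]
    simp [baseNormal, inner_octOne_of_mem h1, -WithLp.prod_inner_apply]
  · refine focalPlus_param_sharp h (octOne + t • v 1) (t • v 3) (-(t • v 0)) ?_
    rw [Oct4.ext_iff]
    simp [baseNormal, u, h2, octConj_smul, octConj_neg, octMul_isNormalized.one_op, add_comm]

theorem exists_isCurveIn_star {v : Oct4} (hv : v ∈ starTangent) :
    ∃ γ, IsCurveIn (focalMinus (fkmPolynomial op)) (mirrorMinus basePoint baseNormal) γ ∧
      deriv γ 0 = v := by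
  obtain ⟨h0, h1, h2⟩ := mem_starTangent.1 hv
  -- For w imaginary and s = |w|²/4, the vector (1 - t²s)e₀ + tw has norm 1 + t²s. Multiplying X and
  -- Y crosswise by these factors gives polynomial curves of equal norm.
  set a := ‖-(√2 • v 2)‖ ^ 2 / 4 with ha
  set b := ‖√2 • v 1‖ ^ 2 / 4 with hb
  let X : ℝ → Oct := fun t =>
    (1 + t ^ 2 * a) • ((1 - t ^ 2 * b) • octOne + t • √2 • v 1)
  let Y : ℝ → Oct := fun t =>
    -((1 + t ^ 2 * b) • ((1 - t ^ 2 * a) • octOne + t • -(√2 • v 2)))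
  have hnorm : ∀ (c s : ℝ) (w : Oct), w ∈ ImOct → s = ‖w‖ ^ 2 / 4 → ∀ t : ℝ,
      ‖(1 + t ^ 2 * c) • ((1 - t ^ 2 * s) • octOne + t • w)‖ ^ 2 =
        (1 + t ^ 2 * c) ^ 2 * (1 + t ^ 2 * s) ^ 2 := by
    intro c s w hw hs t
    rw [norm_smul, mul_pow, norm_add_sq_real (_ • octOne), real_inner_smul_left, real_inner_smul_right,
      real_inner_comm, mem_ImOct.1 hw, norm_smul, norm_smul, norm_octOne, mul_pow, mul_pow]
    simp only [Real.norm_eq_abs, sq_abs]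
    have : ‖w‖ ^ 2 = 4 * s := by linarith
    rw [this]
    ring
  have hX : ∀ t, ‖X t‖ ^ 2 = (1 + t ^ 2 * a) ^ 2 * (1 + t ^ 2 * b) ^ 2 :=
    hnorm a b _ (ImOct.smul_mem _ h1) hb
  have hY : ∀ t, ‖Y t‖ ^ 2 = (1 + t ^ 2 * a) ^ 2 * (1 + t ^ 2 * b) ^ 2 := by
    intro t
    rw [norm_neg, hnorm b a _ (ImOct.neg_mem (ImOct.smul_mem _ h2)) ha, mul_comm]
  have hXY : ∀ t, ‖X t‖ = ‖Y t‖ := fun t => by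
    rw [← sq_eq_sq₀ (norm_nonneg _) (norm_nonneg _), hX, hY]
  -- The curve from `focalMinus_param` with C = t√2 v₃, scaled by 1/√2, minus the base point and
  -- divided by t; the divisions are carried out by hand so that G is smooth at 0.
  let G : ℝ → Oct4 := fun t => (√2)⁻¹ • Oct4.mk (-octMul (X t) (op (octConj (Y t)) (√2 • v 3)))
    ((t * (a - b - t ^ 2 * (a * b))) • octOne + (1 + t ^ 2 * a) • √2 • v 1)
    (-((t * (b - a - t ^ 2 * (a * b))) • octOne + (1 + t ^ 2 * b) • -(√2 • v 2)))
    (((1 + t ^ 2 * a) ^ 2 * (1 + t ^ 2 * b) ^ 2) • √2 • v 3)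
  have hG : ContDiff ℝ ∞ G := by
    refine (contDiff_oct4_mk ?_ ?_ ?_ ?_).const_smul _
    rotate_left 1
    · fun_prop
    · fun_prop
    · fun_prop
    simp only [X, Y, octConj_neg, octConj_smul, octConj_add, map_add, map_smul, map_neg,
      LinearMap.add_apply, LinearMap.smul_apply, LinearMap.neg_apply]
    fun_prop
  have hG0 : G 0 = v := by
    rw [Oct4.ext_iff]
    simp [G, X, Y, octConj_neg, octConj_octOne, octMul_isNormalized.one_op, h.one_op, smul_smul, h0]
  refine exists_isCurveIn_of_smul hG norm_mirrorMinus hG0 ?_ fun t ht => ?_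
  · rw [inner_oct4, mirrorMinus_eq]
    simp [inner_octOne_of_mem h1, inner_octOne_of_mem h2, inner_smul_left,
      -WithLp.prod_inner_apply]
  · obtain ⟨e1, e2⟩ := focalMinus_param h (X t) (Y t) (t • √2 • v 3) (hXY t) rfl
    have e3 : mirrorMinus basePoint baseNormal + t • G t = (√2)⁻¹ •
        Oct4.mk (-octMul (X t) (op (octConj (Y t)) (t • √2 • v 3))) (X t) (Y t)
          (‖X t‖ ^ 2 • t • √2 • v 3) := by
      rw [mirrorMinus_eq, hX, Oct4.ext_iff]
      simp only [PiLp.add_apply, PiLp.smul_apply, G, Oct4.mk_zero, Oct4.mk_one, Oct4.mk_two,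
        Oct4.mk_three]
      refine ⟨?_, ?_, ?_, ?_⟩
      · simp only [map_smul]
        module
      · simp only [X]
        module
      · simp only [Y]
        module
      · module
    rw [e3] at ht ⊢
    generalize Oct4.mk (-octMul (X t) (op (octConj (Y t)) (t • √2 • v 3))) (X t) (Y t)
      (‖X t‖ ^ 2 • t • √2 • v 3) = z at *
    refine normalize_mem_focalMinus h ht ?_ ?_
    · simp only [map_smul, LinearMap.smul_apply, e1, smul_zero]
    · simp only [map_smul, LinearMap.smul_apply, e2]

end Curves

/-! ### Velocities and accelerations; tangent and normal spaces. -/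

section Derivatives

variable {op : Oct →ₗ[ℝ] Oct →ₗ[ℝ] Oct} (h : IsNormalizedOrthogonalMultiplication op)
include h

/-- At the base point A, X and r vanish and p = 1. The first derivative of pX = A r̄ therefore gives
X' = 0, and the second gives X'' = 2A' r̄' with r' = -B'. The sphere condition makes Y' imaginary.
-/
theorem curve_base {γ : ℝ → Oct4} (hγ : IsCurveIn (focalPlus (fkmPolynomial op)) basePoint γ) :
    deriv γ 0 ∈ baseTangent ∧ deriv (deriv γ) 0 1 =
      -((2 : ℝ) • octMul (deriv γ 0 0) (octConj (deriv γ 0 3))) := by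
  have J := ContDiffAt.hasTwoJet hγ.smooth
  rw [hγ.base] at J
  have hn := hγ.inner_deriv fun z hz => hz.1
  generalize deriv (deriv γ) 0 = a at *
  generalize deriv γ 0 = v at *
  have J1 := (J.bilinear formPlus J).bilinear (LinearMap.lsmul ℝ Oct) (J.linear (comp 1))
  have J2 := (J.linear (comp 0)).bilinear octMul
    ((J.bilinear (formOct op) J).linear octConjₗ)
  obtain ⟨-, e1, e2⟩ := J1.congr J2 (hγ.mem.mono fun t ht => focalPlus_eq_one h ht)
  have hxx : formPlus basePoint basePoint = 1 := by
    rw [formPlus_self]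
    simp [basePoint, norm_octOne]
  simp only [hxx, LinearMap.lsmul_apply, comp_apply, formOct_apply, octConjₗ_apply] at e1 e2
  simp [basePoint, octConj_zero, octConj_neg, octConj_octOne, h.one_op] at e1 e2
  rw [e1] at e2
  constructor
  · rw [mem_baseTangent, mem_ImOct]
    refine ⟨e1, ?_⟩
    rw [inner_oct4] at hn
    simpa [basePoint, real_inner_comm, -WithLp.prod_inner_apply] using hn
  · rw [two_smul]
    simpa using e2

/-- Here Y, B and r vanish and m = 1, so mY = B ∘ r̄ yields Y' = 0 and Y'' = 2B' ∘ r̄' with r' = A'.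
-/
theorem curve_sharp {γ : ℝ → Oct4}
    (hγ : IsCurveIn (focalPlus (fkmPolynomial op)) baseNormal γ) :
    deriv γ 0 ∈ sharpTangent ∧ deriv (deriv γ) 0 2 =
      (2 : ℝ) • op (deriv γ 0 3) (octConj (deriv γ 0 0)) := by
  have J := ContDiffAt.hasTwoJet hγ.smooth
  rw [hγ.base] at J
  have hn := hγ.inner_deriv fun z hz => hz.1
  generalize deriv (deriv γ) 0 = a at *
  generalize deriv γ 0 = v at *
  have J1 := (J.bilinear formMinus J).bilinear (LinearMap.lsmul ℝ Oct) (J.linear (comp 2))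
  have J2 := (J.linear (comp 3)).bilinear op
    ((J.bilinear (formOct op) J).linear octConjₗ)
  obtain ⟨-, e1, e2⟩ := J1.congr J2 (hγ.mem.mono fun t ht => focalPlus_eq_two h ht)
  have hxx : formMinus baseNormal baseNormal = 1 := by
    rw [formMinus_self]
    simp [baseNormal, norm_octOne]
  simp only [hxx, LinearMap.lsmul_apply, comp_apply, formOct_apply, octConjₗ_apply] at e1 e2
  simp [baseNormal, octConj_zero, octConj_octOne, octMul_isNormalized.one_op] at e1 e2
  rw [e1] at e2
  constructor
  · rw [mem_sharpTangent, mem_ImOct]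
    refine ⟨?_, e1⟩
    rw [inner_oct4] at hn
    simpa [baseNormal, real_inner_comm, -WithLp.prod_inner_apply] using hn
  · rw [two_smul]
    simpa using e2

/-- The first derivative of r = 0 gives v₀ = v₃; those of p = m and of the sphere equation together
make v₁ and v₂ imaginary. The second derivatives of r = 0 and p = m give the two normal components
of the acceleration. -/
theorem curve_star {γ : ℝ → Oct4}
    (hγ : IsCurveIn (focalMinus (fkmPolynomial op)) (mirrorMinus basePoint baseNormal) γ) :
    deriv γ 0 ∈ starTangent ∧
      deriv (deriv γ) 0 0 - deriv (deriv γ) 0 3 =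
        (2 * √2) • (octMul (deriv γ 0 1) (deriv γ 0 0) + op (deriv γ 0 2) (deriv γ 0 0)) ∧
      ⟪deriv (deriv γ) 0, mirrorNormal basePoint baseNormal⟫_ℝ =
        ⟪deriv γ 0 1, deriv γ 0 1⟫_ℝ - ⟪deriv γ 0 2, deriv γ 0 2⟫_ℝ := by
  have J := ContDiffAt.hasTwoJet hγ.smooth
  rw [hγ.base] at J
  have hn := hγ.inner_deriv fun z hz => hz.1
  generalize deriv (deriv γ) 0 = a at *
  generalize deriv γ 0 = v at *
  obtain ⟨-, e1, e2⟩ := (J.bilinear (formOct op) J).congr (hasTwoJet_const 0)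
    (hγ.mem.mono fun t ht => ((mem_focalMinus_iff h _).1 ht).2.1)
  obtain ⟨-, e3, e4⟩ := (J.bilinear formPlus J).congr (J.bilinear formMinus J)
    (hγ.mem.mono fun t ht => ((mem_focalMinus_iff h _).1 ht).2.2)
  rw [mirrorMinus_eq] at e1 e2 e3 e4 hn
  simp only [formOct_apply, formPlus_apply, formMinus_apply, inner_oct4, Oct4.mk_zero, Oct4.mk_one,
    Oct4.mk_two, Oct4.mk_three, octConj_neg, octConj_smul, octConj_octOne, map_neg, map_smul,
    map_zero, LinearMap.neg_apply, LinearMap.smul_apply, octMul_isNormalized.one_op, h.one_op,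
    inner_zero_left, inner_zero_right, inner_neg_left, inner_neg_right, real_inner_smul_left,
    real_inner_smul_right, add_zero, zero_add, real_inner_comm octOne]
    at e1 e2 e3 e4 hn
  have hs : (√2)⁻¹ ≠ (0 : ℝ) := by positivity
  have h03 : v 0 = v 3 := by
    rw [← sub_eq_add_neg, ← smul_sub, smul_eq_zero_iff_right hs] at e1
    exact sub_eq_zero.1 e1
  have h1 : ⟪octOne, v 1⟫_ℝ = 0 := by
    have : (√2)⁻¹ * ⟪octOne, v 1⟫_ℝ = 0 := by linarith
    simpa [hs, -WithLp.prod_inner_apply] using this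
  have h2 : ⟪octOne, v 2⟫_ℝ = 0 := by
    have : (√2)⁻¹ * ⟪octOne, v 2⟫_ℝ = 0 := by linarith
    simpa [hs, -WithLp.prod_inner_apply] using this
  have m1 : v 1 ∈ ImOct := by rwa [mem_ImOct, real_inner_comm]
  have m2 : v 2 ∈ ImOct := by rwa [mem_ImOct, real_inner_comm]
  refine ⟨mem_starTangent.2 ⟨h03, m1, m2⟩, ?_, ?_⟩
  · rw [octConj_of_mem m1, octConj_of_mem m2, ← h03] at e2
    simp only [map_neg, LinearMap.neg_apply] at e2
    have e5 : √2 • (√2)⁻¹ • (a 0 - a 3) =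
        √2 • (2 : ℝ) • (octMul (v 1) (v 0) + op (v 2) (v 0)) := by
      congr 1
      rw [← sub_eq_zero, ← e2]
      module
    rw [smul_smul, sqrt_two_mul_inv, one_smul, smul_smul] at e5
    rw [e5, mul_comm]
  · rw [mirrorNormal_eq, inner_oct4]
    simp only [Oct4.mk_zero, Oct4.mk_one, Oct4.mk_two, Oct4.mk_three, inner_zero_right,
      inner_neg_right, real_inner_smul_right, real_inner_comm octOne]
    rw [← h03] at e4
    linarith

theorem tangentSpace_base :
    tangentSpace (focalPlus (fkmPolynomial op)) basePoint = baseTangent :=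
  tangentSpace_eq (fun _ hγ => (curve_base h hγ).1) fun _ hv => exists_isCurveIn_base h hv

theorem tangentSpace_sharp :
    tangentSpace (focalPlus (fkmPolynomial op)) baseNormal = sharpTangent :=
  tangentSpace_eq (fun _ hγ => (curve_sharp h hγ).1) fun _ hv => exists_isCurveIn_sharp h hv

theorem tangentSpace_star :
    tangentSpace (focalMinus (fkmPolynomial op)) (mirrorMinus basePoint baseNormal) =
      starTangent :=
  tangentSpace_eq (fun _ hγ => (curve_star h hγ).1) fun _ hv => exists_isCurveIn_star h hv

theorem mem_normalSpace_base {n : Oct4} :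
    n ∈ normalSpace (focalPlus (fkmPolynomial op)) basePoint ↔ n 0 = 0 ∧ n 2 = 0 ∧ n 3 = 0 := by
  rw [mem_normalSpace, tangentSpace_base h]
  simp only [mem_baseTangent, inner_oct4]
  constructor
  · rintro ⟨h1, h2⟩
    have t0 := h1 (Oct4.mk (n 0) 0 0 0) ⟨rfl, ImOct.zero_mem⟩
    have t3 := h1 (Oct4.mk 0 0 0 (n 3)) ⟨rfl, ImOct.zero_mem⟩
    have t2 := h1 (Oct4.mk 0 0 (n 2) 0)
    simp [basePoint, -WithLp.prod_inner_apply] at t0 t3 t2 h2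
    refine ⟨t0, t2 ?_, t3⟩
    rw [mem_ImOct, real_inner_comm, h2]
  · rintro ⟨h0, h2, h3⟩
    simp only [h0, h2, h3, basePoint, Oct4.mk_one, inner_zero_right, inner_zero_left, add_zero,
      zero_add, and_true]
    rintro v ⟨h1, -⟩
    rw [h1, inner_zero_left]

theorem mem_normalSpace_sharp {n : Oct4} :
    n ∈ normalSpace (focalPlus (fkmPolynomial op)) baseNormal ↔ n 0 = 0 ∧ n 1 = 0 ∧ n 3 = 0 := by
  rw [mem_normalSpace, tangentSpace_sharp h]
  simp only [mem_sharpTangent, inner_oct4]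
  constructor
  · rintro ⟨h1, h2⟩
    have t0 := h1 (Oct4.mk (n 0) 0 0 0) ⟨ImOct.zero_mem, rfl⟩
    have t3 := h1 (Oct4.mk 0 0 0 (n 3)) ⟨ImOct.zero_mem, rfl⟩
    have t2 := h1 (Oct4.mk 0 (n 1) 0 0)
    simp [baseNormal, -WithLp.prod_inner_apply] at t0 t3 t2 h2
    refine ⟨t0, t2 ?_, t3⟩
    rw [mem_ImOct, real_inner_comm, h2]
  · rintro ⟨h0, h2, h3⟩
    simp only [h0, h2, h3, baseNormal, Oct4.mk_two, inner_zero_right, inner_zero_left, add_zero,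
      zero_add, and_true]
    rintro v ⟨-, h1⟩
    rw [h1, inner_zero_left]

theorem normalSpace_star :
    normalSpace (focalMinus (fkmPolynomial op)) (mirrorMinus basePoint baseNormal) =
      Submodule.span ℝ {mirrorNormal basePoint baseNormal} ⊔
        LinearMap.range framePos.toLinearMap := by
  have hs : (√2)⁻¹ ≠ (0 : ℝ) := by positivity
  ext n
  rw [mem_normalSpace, tangentSpace_star h]
  simp only [mem_starTangent, inner_oct4, Submodule.mem_sup, Submodule.mem_span_singleton]
  constructor
  · rintro ⟨h1, h2⟩
    have t0 := h1 (Oct4.mk (n 0 + n 3) 0 0 (n 0 + n 3)) ⟨rfl, ImOct.zero_mem, ImOct.zero_mem⟩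
    -- Testing against the imaginary part of the component itself forces that component to be real.
    have t1 := h1 (Oct4.mk 0 (n 1 - ⟪octOne, n 1⟫_ℝ • octOne) 0 0)
    have t2 := h1 (Oct4.mk 0 0 (n 2 - ⟪octOne, n 2⟫_ℝ • octOne) 0)
    have im : ∀ y : Oct, y - ⟪octOne, y⟫_ℝ • octOne ∈ ImOct := by
      intro y
      rw [mem_ImOct, inner_sub_left, real_inner_smul_left, real_inner_self_eq_norm_sq,
        norm_octOne, real_inner_comm]
      ring
    have key : ∀ y : Oct, ⟪y - ⟪octOne, y⟫_ℝ • octOne, y⟫_ℝ = 0 → y = ⟪octOne, y⟫_ℝ • octOne := by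
      intro y hy
      rw [← sub_eq_zero, ← inner_self_eq_zero (𝕜 := ℝ), inner_sub_right _ y, hy,
        real_inner_smul_right, mem_ImOct.1 (im y)]
      ring
    simp only [Oct4.mk_zero, Oct4.mk_one, Oct4.mk_two, Oct4.mk_three, inner_zero_left, add_zero,
      zero_add, ImOct.zero_mem, im, and_self, true_imp_iff] at t0 t1 t2
    rw [← inner_add_right, inner_self_eq_zero] at t0
    replace t1 := key _ t1
    replace t2 := key _ t2
    rw [mirrorMinus_eq] at h2
    simp only [Oct4.mk_zero, Oct4.mk_one, Oct4.mk_two, Oct4.mk_three, inner_zero_left, add_zero,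
      zero_add, inner_neg_left, real_inner_smul_left] at h2
    have h3 : ⟪octOne, n 1⟫_ℝ = ⟪octOne, n 2⟫_ℝ := by
      have : (√2)⁻¹ * (⟪octOne, n 1⟫_ℝ - ⟪octOne, n 2⟫_ℝ) = 0 := by linarith
      rw [mul_eq_zero, or_iff_right hs] at this
      exact sub_eq_zero.1 this
    refine ⟨_, ⟨-(√2 * ⟪octOne, n 1⟫_ℝ), rfl⟩, _, ⟨√2 • n 0, rfl⟩, ?_⟩
    rw [LinearIsometry.coe_toLinearMap, framePos_apply, smul_smul, sqrt_two_inv_mul, one_smul,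
      mirrorNormal_eq, Oct4.ext_iff]
    have h4 : ∀ c : ℝ, -(√2 * c) • -((√2)⁻¹ • octOne) = c • octOne := by
      intro c
      rw [neg_smul_neg, smul_smul, mul_right_comm, sqrt_two_mul_inv, one_mul]
    simp only [PiLp.add_apply, PiLp.smul_apply, Oct4.mk_zero, Oct4.mk_one, Oct4.mk_two,
      Oct4.mk_three, smul_zero, zero_add, add_zero, h4]
    refine ⟨trivial, t1.symm, ?_, ?_⟩
    · rw [h3]
      exact t2.symm
    · exact neg_eq_of_add_eq_zero_right t0
  · rintro ⟨_, ⟨c, rfl⟩, _, ⟨u, rfl⟩, rfl⟩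
    rw [LinearIsometry.coe_toLinearMap, framePos_apply, mirrorNormal_eq, mirrorMinus_eq]
    simp only [PiLp.add_apply, PiLp.smul_apply, Oct4.mk_zero, Oct4.mk_one, Oct4.mk_two,
      Oct4.mk_three, smul_zero, zero_add, add_zero, inner_zero_left, inner_neg_left,
      add_neg_cancel, and_true]
    rintro v ⟨h0, h1, h2⟩
    simp only [h0, smul_neg, inner_neg_right, real_inner_smul_right, mem_ImOct.1 h1,
      mem_ImOct.1 h2]
    ring

end Derivatives

/-! ### Second fundamental forms, shape operators and the mirror frame. -/

section Forms

theorem framePos_add_frameNeg_add_frameKer (u v : Oct) (y : ImOct) :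
    (framePos u + frameNeg v + frameKer y) 0 = (√2)⁻¹ • (u - v) ∧
    (framePos u + frameNeg v + frameKer y) 3 = -((√2)⁻¹ • (u + v)) := by
  simp only [framePos_apply, frameNeg_apply, frameKer_apply, PiLp.add_apply, Oct4.mk_zero,
    Oct4.mk_three]
  constructor <;> module

theorem framePos_add_frameNeg_add_frameNormal (u v : Oct) (y : ImOct) :
    (framePos u + frameNeg v + frameNormal y) 0 = (√2)⁻¹ • (u - v) ∧
    (framePos u + frameNeg v + frameNormal y) 3 = -((√2)⁻¹ • (u + v)) := by
  simp only [framePos_apply, frameNeg_apply, frameNormal_apply, PiLp.add_apply, Oct4.mk_zero,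
    Oct4.mk_three]
  constructor <;> module

/-- The eigenvalue equation shared by both points of M₊, where the shape operator exchanges the
first and last components with a minus sign and kills the remaining one. The forward direction tests
with the defects of the asserted equations. -/
theorem forall_hyperbolic_eq_iff {c : ℝ} {p q r : Oct} (hr : r ∈ ImOct) :
    (∀ a b y : Oct, y ∈ ImOct →
      -(⟪p, b⟫_ℝ + ⟪a, q⟫_ℝ) = c * (⟪p, a⟫_ℝ + ⟪r, y⟫_ℝ + ⟪q, b⟫_ℝ)) ↔
      q = -(c • p) ∧ p = -(c • q) ∧ c • r = 0 := by
  constructor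
  · intro H
    refine ⟨?_, ?_, ?_⟩
    · have := H (q + c • p) 0 0 ImOct.zero_mem
      rw [eq_neg_iff_add_eq_zero, ← inner_self_eq_zero (𝕜 := ℝ), inner_add_right,
        real_inner_smul_right, real_inner_comm p]
      simp only [inner_zero_right, add_zero, zero_add] at this
      linarith
    · have := H 0 (p + c • q) 0 ImOct.zero_mem
      rw [eq_neg_iff_add_eq_zero, ← inner_self_eq_zero (𝕜 := ℝ), inner_add_left,
        real_inner_smul_left]
      simp only [inner_zero_right, inner_zero_left, add_zero, zero_add] at this
      linarith
    · have := H 0 0 r hr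
      simp only [inner_zero_right, inner_zero_left, add_zero, zero_add, neg_zero] at this
      rw [← inner_self_eq_zero (𝕜 := ℝ), real_inner_smul_left, real_inner_smul_right, ← this,
        mul_zero]
  · rintro ⟨h1, h2, h3⟩ a b y -
    have e1 : ⟪p, b⟫_ℝ = -(c * ⟪q, b⟫_ℝ) := by
      conv_lhs => rw [h2]
      rw [inner_neg_left, real_inner_smul_left]
    have e2 : ⟪a, q⟫_ℝ = -(c * ⟪p, a⟫_ℝ) := by
      conv_lhs => rw [h1]
      rw [inner_neg_right, real_inner_smul_right, real_inner_comm]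
    have e3 : c * ⟪r, y⟫_ℝ = 0 := by rw [← real_inner_smul_left, h3, inner_zero_left]
    rw [e1, e2]
    linarith

variable {op : Oct →ₗ[ℝ] Oct →ₗ[ℝ] Oct} (h : IsNormalizedOrthogonalMultiplication op)
include h

theorem IsNormalizedOrthogonalMultiplication.inner_op_skew {a : Oct} (ha : a ∈ ImOct) (u v : Oct) :
    ⟪u, op a v⟫_ℝ = -⟪v, op a u⟫_ℝ := by
  rw [real_inner_comm, h.inner_op_eq_left, octConj_of_mem ha, map_neg, LinearMap.neg_apply,
    inner_neg_right]

theorem isSecondFundamentalForm_base :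
    IsSecondFundamentalForm (focalPlus (fkmPolynomial op)) basePoint baseForm where
  velocity v hv := exists_isCurveIn_base h (tangentSpace_base h ▸ hv)
  symm u _ v _ := by rw [baseForm_apply, baseForm_apply, add_comm]
  mem_normal u _ v _ := by
    rw [mem_normalSpace_base h, baseForm_apply]
    simp
  curve γ hγ n hn := by
    obtain ⟨h0, h2, h3⟩ := (mem_normalSpace_base h).1 hn
    rw [inner_oct4, inner_oct4, h0, h2, h3, (curve_base h hγ).2, baseForm_apply, two_smul]
    simp only [inner_zero_right, PiLp.neg_apply, Oct4.mk_one]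

theorem isSecondFundamentalForm_sharp :
    IsSecondFundamentalForm (focalPlus (fkmPolynomial op)) baseNormal (sharpForm op) where
  velocity v hv := exists_isCurveIn_sharp h (tangentSpace_sharp h ▸ hv)
  symm u _ v _ := by rw [sharpForm_apply, sharpForm_apply, add_comm]
  mem_normal u _ v _ := by
    rw [mem_normalSpace_sharp h, sharpForm_apply]
    simp
  curve γ hγ n hn := by
    obtain ⟨h0, h2, h3⟩ := (mem_normalSpace_sharp h).1 hn
    rw [inner_oct4, inner_oct4, h0, h2, h3, (curve_sharp h hγ).2, sharpForm_apply, two_smul]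
    simp only [inner_zero_right, Oct4.mk_two]

theorem isSecondFundamentalForm_star :
    IsSecondFundamentalForm (focalMinus (fkmPolynomial op)) (mirrorMinus basePoint baseNormal)
      (starForm op) where
  velocity v hv := exists_isCurveIn_star h (tangentSpace_star h ▸ hv)
  symm u _ v _ := by
    rw [starForm_apply, starForm_apply, real_inner_comm, real_inner_comm (u 2), add_comm (_ + op _ _)]
  mem_normal u _ v _ := by
    rw [normalSpace_star h, starForm_apply]
    exact Submodule.add_mem_sup (Submodule.smul_mem _ _ (Submodule.mem_span_singleton_self _))
      ⟨_, rfl⟩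
  curve γ hγ n hn := by
    obtain ⟨-, h1, h2⟩ := curve_star h hγ
    rw [normalSpace_star h, Submodule.mem_sup] at hn
    obtain ⟨n', hn', _, ⟨u, rfl⟩, rfl⟩ := hn
    obtain ⟨c, rfl⟩ := Submodule.mem_span_singleton.1 hn'
    rw [inner_add_right, inner_add_right, real_inner_smul_right, real_inner_smul_right, h2,
      starForm_apply]
    have e1 : ∀ x : Oct, ⟪framePos x, mirrorNormal basePoint baseNormal⟫_ℝ = 0 := by
      intro x
      rw [framePos_apply, mirrorNormal_eq, inner_oct4]
      simp
    have e2 : ⟪deriv (deriv γ) 0, framePos u⟫_ℝ =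
        (√2)⁻¹ * ⟪deriv (deriv γ) 0 0 - deriv (deriv γ) 0 3, u⟫_ℝ := by
      rw [framePos_apply, inner_oct4, inner_sub_left]
      simp only [Oct4.mk_zero, Oct4.mk_one, Oct4.mk_two, Oct4.mk_three, inner_zero_right,
        inner_neg_right, real_inner_smul_right]
      ring
    rw [LinearIsometry.coe_toLinearMap, e2, h1, inner_add_left, inner_add_left, e1,
      real_inner_smul_left, real_inner_smul_left, real_inner_smul_left, LinearIsometry.inner_map_map,
      real_inner_self_eq_norm_sq (mirrorNormal _ _), norm_mirrorNormal,
      real_inner_comm (framePos u), e1, ← two_smul ℝ, real_inner_smul_left, ← mul_assoc _ (2 * √2),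
      mul_left_comm _ 2 √2, sqrt_two_inv_mul]
    ring

theorem mem_shapeEigenspace_base {c : ℝ} {z : Oct4} :
    z ∈ shapeEigenspace (focalPlus (fkmPolynomial op)) basePoint baseForm baseNormal c ↔
      z 1 = 0 ∧ z 2 ∈ ImOct ∧ z 3 = -(c • z 0) ∧ z 0 = -(c • z 3) ∧ c • z 2 = 0 := by
  have hI : ∀ v w : Oct4, ⟪baseForm v w, baseNormal⟫_ℝ = -(⟪v 0, w 3⟫_ℝ + ⟪w 0, v 3⟫_ℝ) := by
    intro v w
    rw [baseForm_apply, inner_neg_left, inner_oct4]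
    simp only [baseNormal, Oct4.mk_zero, Oct4.mk_one, Oct4.mk_two, Oct4.mk_three, inner_zero_right,
      inner_add_left, octMul_isNormalized.inner_op_eq_right, octConj_octConj,
      octMul_isNormalized.one_op, add_zero, zero_add]
  change z ∈ tangentSpace _ _ ∧ (∀ w ∈ tangentSpace _ _, _) ↔ _
  rw [tangentSpace_base h, mem_baseTangent, and_assoc, and_congr_right_iff]
  intro h1
  rw [and_congr_right_iff]
  intro h2
  rw [← forall_hyperbolic_eq_iff h2]
  constructor
  · intro H a b y hy
    have := H (Oct4.mk a 0 y b) (mem_baseTangent.2 ⟨rfl, hy⟩)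
    rw [hI, inner_oct4, h1, inner_zero_left] at this
    simpa only [Oct4.mk_zero, Oct4.mk_two, Oct4.mk_three, add_zero] using this
  · intro H w hw
    rw [hI, inner_oct4, h1, inner_zero_left, add_zero]
    exact H _ _ _ (mem_baseTangent.1 hw).2

theorem mem_shapeEigenspace_sharp {c : ℝ} {z : Oct4} :
    z ∈ shapeEigenspace (focalPlus (fkmPolynomial op)) baseNormal (sharpForm op) basePoint c ↔
      z 2 = 0 ∧ z 1 ∈ ImOct ∧ z 3 = -(c • z 0) ∧ z 0 = -(c • z 3) ∧ c • z 1 = 0 := by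
  have hI : ∀ v w : Oct4, ⟪sharpForm op v w, basePoint⟫_ℝ = -(⟪v 0, w 3⟫_ℝ + ⟪w 0, v 3⟫_ℝ) := by
    intro v w
    rw [sharpForm_apply, inner_oct4]
    simp only [basePoint, Oct4.mk_zero, Oct4.mk_one, Oct4.mk_two, Oct4.mk_three, inner_zero_right,
      inner_add_left, h.inner_op_eq_right, octConj_octConj, inner_neg_right,
      h.one_op, add_zero, zero_add]
    rw [real_inner_comm (v 0), real_inner_comm (w 0)]
    ring
  change z ∈ tangentSpace _ _ ∧ (∀ w ∈ tangentSpace _ _, _) ↔ _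
  rw [tangentSpace_sharp h, mem_sharpTangent, and_comm (a := z 1 ∈ ImOct), and_assoc,
    and_congr_right_iff]
  intro h1
  rw [and_congr_right_iff]
  intro h2
  rw [← forall_hyperbolic_eq_iff h2]
  constructor
  · intro H a b y hy
    have := H (Oct4.mk a y 0 b) (mem_sharpTangent.2 ⟨hy, rfl⟩)
    rw [hI, inner_oct4, h1, inner_zero_left] at this
    simpa only [Oct4.mk_zero, Oct4.mk_one, Oct4.mk_three, add_zero] using this
  · intro H w hw
    rw [hI, inner_oct4, h1, inner_zero_left, add_zero]
    exact H _ _ _ (mem_sharpTangent.1 hw).1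

theorem mem_shapeEigenspace_star {c : ℝ} {z : Oct4} :
    z ∈ shapeEigenspace (focalMinus (fkmPolynomial op)) (mirrorMinus basePoint baseNormal)
      (starForm op) (mirrorNormal basePoint baseNormal) c ↔
      z 0 = z 3 ∧ z 1 ∈ ImOct ∧ z 2 ∈ ImOct ∧ c • z 0 = 0 ∧ (1 - c) • z 1 = 0 ∧
        (1 + c) • z 2 = 0 := by
  have hI : ∀ v w : Oct4, ⟪starForm op v w, mirrorNormal basePoint baseNormal⟫_ℝ =
      ⟪v 1, w 1⟫_ℝ - ⟪v 2, w 2⟫_ℝ := by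
    intro v w
    have e1 : ∀ x : Oct, ⟪framePos x, mirrorNormal basePoint baseNormal⟫_ℝ = 0 := by
      intro x
      rw [framePos_apply, mirrorNormal_eq, inner_oct4]
      simp
    rw [starForm_apply, inner_add_left, e1, real_inner_smul_left, real_inner_self_eq_norm_sq,
      norm_mirrorNormal]
    ring
  have key : ∀ {d : ℝ} {x : Oct}, d * ⟪x, x⟫_ℝ = 0 → d • x = 0 := by
    intro d x hd
    rcases mul_eq_zero.1 hd with hd | hd
    · rw [hd, zero_smul]
    · rw [inner_self_eq_zero.1 hd, smul_zero]
  change z ∈ tangentSpace _ _ ∧ (∀ w ∈ tangentSpace _ _, _) ↔ _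
  rw [tangentSpace_star h, mem_starTangent, and_assoc, and_congr_right_iff]
  intro h0
  rw [and_assoc, and_congr_right_iff]
  intro h1
  rw [and_congr_right_iff]
  intro h2
  constructor
  · intro H
    have t0 := H (Oct4.mk (z 0) 0 0 (z 0))
      (mem_starTangent.2 ⟨rfl, ImOct.zero_mem, ImOct.zero_mem⟩)
    have t1 := H (Oct4.mk 0 (z 1) 0 0) (mem_starTangent.2 ⟨rfl, h1, ImOct.zero_mem⟩)
    have t2 := H (Oct4.mk 0 0 (z 2) 0) (mem_starTangent.2 ⟨rfl, ImOct.zero_mem, h2⟩)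
    rw [hI, inner_oct4] at t0 t1 t2
    simp only [Oct4.mk_zero, Oct4.mk_one, Oct4.mk_two, Oct4.mk_three, inner_zero_right, ← h0,
      add_zero, zero_add, sub_zero, zero_sub] at t0 t1 t2
    exact ⟨key (by linarith), key (by linarith), key (by linarith)⟩
  · rintro ⟨e0, e1, e2⟩ w -
    have f0 : c * ⟪z 0, w 0⟫_ℝ = 0 := by rw [← real_inner_smul_left, e0, inner_zero_left]
    have f3 : c * ⟪z 3, w 3⟫_ℝ = 0 := by rw [← real_inner_smul_left, ← h0, e0, inner_zero_left]
    have f1 : (1 - c) * ⟪z 1, w 1⟫_ℝ = 0 := by rw [← real_inner_smul_left, e1, inner_zero_left]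
    have f2 : (1 + c) * ⟪z 2, w 2⟫_ℝ = 0 := by rw [← real_inner_smul_left, e2, inner_zero_left]
    rw [hI, inner_oct4]
    linarith

/-- For any nonzero normal vector, left multiplication by its octonion component is invertible. The
form couples the first and last components through this map, so its kernel is always the imaginary
third component. -/
theorem conditionA_base : ConditionA (focalPlus (fkmPolynomial op)) basePoint := by
  refine ⟨baseForm, isSecondFundamentalForm_base h, LinearMap.range frameKer.toLinearMap, ?_⟩
  intro n hn hn0
  obtain ⟨n0, n2, n3⟩ := (mem_normalSpace_base h).1 hn
  have hne : n 1 ≠ 0 := fun n1 => hn0 (Oct4.ext_iff.2 ⟨n0, n1, n2, n3⟩)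
  have hI : ∀ v w : Oct4, ⟪baseForm v w, n⟫_ℝ =
      -(⟪v 0, octMul (n 1) (w 3)⟫_ℝ + ⟪w 0, octMul (n 1) (v 3)⟫_ℝ) := by
    intro v w
    rw [baseForm_apply, inner_neg_left, inner_oct4, n0, n2, n3]
    simp only [Oct4.mk_one, inner_zero_right,
      inner_add_left, octMul_isNormalized.inner_op_eq_right, octConj_octConj, add_zero, zero_add]
  ext z
  rw [mem_range_frameKer]
  change z ∈ tangentSpace _ _ ∧ (∀ w ∈ tangentSpace _ _, _) ↔ _
  rw [tangentSpace_base h, mem_baseTangent]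
  constructor
  · rintro ⟨⟨h1, h2⟩, H⟩
    -- These two test vectors turn the pairings into |n₁|²|z₃|² and |n₁|²|z₀|², up to sign.
    have t3 := H (Oct4.mk (octMul (n 1) (z 3)) 0 0 0) (mem_baseTangent.2 ⟨rfl, ImOct.zero_mem⟩)
    have t0 := H (Oct4.mk 0 0 0 (octMul (octConj (n 1)) (z 0)))
      (mem_baseTangent.2 ⟨rfl, ImOct.zero_mem⟩)
    rw [hI] at t0 t3
    have e := octMul_isNormalized.op_conj_op (octConj (n 1)) (z 0)
    rw [octConj_octConj, norm_octConj] at e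
    simp only [Oct4.mk_zero, Oct4.mk_three, map_zero, inner_zero_right, inner_zero_left, zero_mul,
      add_zero, zero_add, neg_eq_zero, e, real_inner_smul_right, mul_eq_zero, inner_self_eq_zero,
      octMul_isNormalized.inner_op_left] at t0 t3
    have hsq : ‖n 1‖ ^ 2 ≠ 0 := pow_ne_zero 2 (norm_ne_zero_iff.2 hne)
    exact ⟨t0.resolve_left hsq, h1, h2, t3.resolve_left hsq⟩
  · rintro ⟨h0, h1, h2, h3⟩
    refine ⟨⟨h1, h2⟩, fun w _ => ?_⟩
    rw [hI, h0, h3]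
    simp

theorem isMirrorPair_base : IsMirrorPair (fkmPolynomial op) basePoint baseNormal where
  mem := basePoint_mem h
  conditionA := conditionA_base h
  normal := (mem_normalSpace_base h).2 ⟨rfl, rfl, rfl⟩
  unit := norm_baseNormal
  mem_sharp := baseNormal_mem h
  mem_star := mirrorMinus_mem h

/-- Holds for every normalized multiplication: the octonion product governs the components A, X and
hence the form at x, while ∘ governs Y, B and hence the form at x#. Both meet at x⋆. -/
theorem isMirrorFrame_base : IsMirrorFrame (fkmPolynomial op) basePoint baseNormal op baseForm
    (sharpForm op) (starForm op) framePos frameNeg frameNormal frameKer where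
  form := isSecondFundamentalForm_base h
  tangent := tangentSpace_base h
  normal := by
    ext z
    rw [mem_range_frameNormal, Submodule.mem_inf, mem_normalSpace_base h,
      Submodule.mem_orthogonal_singleton_iff_inner_left, inner_oct4, mem_ImOct]
    simp only [baseNormal, Oct4.mk_zero, Oct4.mk_one, Oct4.mk_two, Oct4.mk_three, inner_zero_right,
      add_zero, zero_add]
    tauto
  eigen_pos := by
    ext z
    rw [mem_range_framePos, mem_shapeEigenspace_base h]
    simp only [one_smul]
    constructor
    · rintro ⟨h1, h2, h3⟩
      exact ⟨h1, h2 ▸ ImOct.zero_mem, h3, by rw [h3, neg_neg], h2⟩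
    · rintro ⟨h1, -, h3, -, h2⟩
      exact ⟨h1, h2, h3⟩
  eigen_neg := by
    ext z
    rw [mem_range_frameNeg, mem_shapeEigenspace_base h]
    simp only [neg_smul, one_smul, neg_neg, neg_eq_zero]
    constructor
    · rintro ⟨h1, h2, h3⟩
      exact ⟨h1, h2 ▸ ImOct.zero_mem, h3, h3.symm, h2⟩
    · rintro ⟨h1, -, h3, -, h2⟩
      exact ⟨h1, h2, h3⟩
  eigen_zero := by
    ext z
    rw [mem_range_frameKer, mem_shapeEigenspace_base h]
    simp only [zero_smul, neg_zero]
    tauto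
  form_eq a y u v := by
    obtain ⟨e0, e3⟩ := framePos_add_frameNeg_add_frameKer u v y
    rw [baseForm_apply, inner_neg_left, inner_oct4, e0, e3, frameNormal_apply, ← two_smul ℝ]
    have e : ⟪octMul ((√2)⁻¹ • (u - v)) (octConj (-((√2)⁻¹ • (u + v)))), (a : Oct)⟫_ℝ =
        -((√2)⁻¹ * (√2)⁻¹) * ⟪u - v, octMul a (u + v)⟫_ℝ := by
      rw [octMul_isNormalized.inner_op_eq_right, octConj_octConj, map_neg, map_smul,
        inner_neg_right, real_inner_smul_left, real_inner_smul_right]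
      ring
    simp only [Oct4.mk_zero, Oct4.mk_one, Oct4.mk_two, Oct4.mk_three, inner_zero_right,
      real_inner_smul_left, e]
    rw [map_add, inner_sub_left, inner_add_right, inner_add_right]
    -- Left multiplication by an imaginary element is skew, so the pure u and v terms vanish and the
    -- two mixed terms coincide.
    have s1 := octMul_isNormalized.inner_op_skew a.2 u u
    have s2 := octMul_isNormalized.inner_op_skew a.2 v v
    have s3 := octMul_isNormalized.inner_op_skew a.2 v u
    rw [real_inner_comm u (octMul a v), s3, sqrt_two_inv_mul_self]
    linarith
  form_sharp := isSecondFundamentalForm_sharp h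
  tangent_sharp := tangentSpace_sharp h
  normal_sharp := by
    ext z
    rw [mem_range_frameKer, Submodule.mem_inf, mem_normalSpace_sharp h,
      Submodule.mem_orthogonal_singleton_iff_inner_left, inner_oct4, mem_ImOct]
    simp only [basePoint, Oct4.mk_zero, Oct4.mk_one, Oct4.mk_two, Oct4.mk_three, inner_zero_right,
      add_zero, zero_add, inner_neg_right, neg_eq_zero]
    tauto
  eigen_sharp_pos := by
    ext z
    rw [mem_range_framePos, mem_shapeEigenspace_sharp h]
    simp only [one_smul]
    constructor
    · rintro ⟨h1, h2, h3⟩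
      exact ⟨h2, h1 ▸ ImOct.zero_mem, h3, by rw [h3, neg_neg], h1⟩
    · rintro ⟨h1, -, h3, -, h2⟩
      exact ⟨h2, h1, h3⟩
  eigen_sharp_neg := by
    ext z
    rw [mem_range_frameNeg, mem_shapeEigenspace_sharp h]
    simp only [neg_smul, one_smul, neg_neg, neg_eq_zero]
    constructor
    · rintro ⟨h1, h2, h3⟩
      exact ⟨h2, h1 ▸ ImOct.zero_mem, h3, h3.symm, h1⟩
    · rintro ⟨h1, -, h3, -, h2⟩
      exact ⟨h2, h1, h3⟩
  eigen_sharp_zero := by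
    ext z
    rw [mem_range_frameNormal, mem_shapeEigenspace_sharp h]
    simp only [zero_smul, neg_zero]
    tauto
  form_sharp_eq a y u v := by
    obtain ⟨e0, e3⟩ := framePos_add_frameNeg_add_frameNormal u v y
    rw [sharpForm_apply, inner_oct4, e0, e3, frameKer_apply, ← two_smul ℝ]
    have e : ⟪op (-((√2)⁻¹ • (u + v))) (octConj ((√2)⁻¹ • (u - v))), (a : Oct)⟫_ℝ =
        -((√2)⁻¹ * (√2)⁻¹) * ⟪u + v, op a (u - v)⟫_ℝ := by
      rw [h.inner_op_eq_right, octConj_octConj, map_smul, inner_neg_left, real_inner_smul_left,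
        real_inner_smul_right]
      ring
    simp only [Oct4.mk_zero, Oct4.mk_one, Oct4.mk_two, Oct4.mk_three, inner_zero_right,
      real_inner_smul_left, e]
    rw [map_sub, inner_add_left, inner_sub_right, inner_sub_right]
    have s1 := h.inner_op_skew a.2 u u
    have s2 := h.inner_op_skew a.2 v v
    have s3 := h.inner_op_skew a.2 v u
    rw [real_inner_comm u (op a v), s3, sqrt_two_inv_mul_self]
    linarith
  form_star := isSecondFundamentalForm_star h
  tangent_star := tangentSpace_star h
  normal_star := normalSpace_star h
  eigen_star_pos := by
    ext z
    rw [mem_range_frameNormal, mem_shapeEigenspace_star h]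
    simp only [one_smul, sub_self, zero_smul]
    norm_num
    constructor
    · rintro ⟨h0, h1, h2, h3⟩
      exact ⟨h0.trans h3.symm, h1, h2 ▸ ImOct.zero_mem, h0, h2⟩
    · rintro ⟨h3, h1, -, h0, h2⟩
      exact ⟨h0, h1, h2, h3 ▸ h0⟩
  eigen_star_neg := by
    ext z
    rw [mem_range_frameKer, mem_shapeEigenspace_star h]
    norm_num
    constructor
    · rintro ⟨h0, h1, h2, h3⟩
      exact ⟨h0.trans h3.symm, h1 ▸ ImOct.zero_mem, h2, h0, h1⟩
    · rintro ⟨h3, -, h2, h0, h1⟩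
      exact ⟨h0, h1, h2, h3 ▸ h0⟩
  eigen_star_zero := by
    ext z
    rw [mem_range_frameNeg, mem_shapeEigenspace_star h]
    norm_num
    constructor
    · rintro ⟨h1, h2, h3⟩
      exact ⟨h3.symm, h1 ▸ ImOct.zero_mem, h2 ▸ ImOct.zero_mem, h1, h2⟩
    · rintro ⟨h3, -, -, h1, h2⟩
      exact ⟨h1, h2, h3.symm⟩
  form_star_eq X Y Z := by
    have e0 : (frameNormal X + frameKer Y + frameNeg Z) 0 = -((√2)⁻¹ • Z) := by
      simp [frameNormal_apply, frameKer_apply, frameNeg_apply]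
    have e1 : (frameNormal X + frameKer Y + frameNeg Z) 1 = X := by
      simp [frameNormal_apply, frameKer_apply, frameNeg_apply]
    have e2 : (frameNormal X + frameKer Y + frameNeg Z) 2 = Y := by
      simp [frameNormal_apply, frameKer_apply, frameNeg_apply]
    -- The symmetrized form doubles the product, and the identification of V₋ contributes -1/√2,
    -- which gives the factor -√2.
    have e3 : 2 * (√2)⁻¹ = √2 := by
      rw [mul_inv_eq_iff_eq_mul₀ (by positivity), Real.mul_self_sqrt zero_le_two]
    rw [starForm_apply, e0, e1, e2, real_inner_self_eq_norm_sq, real_inner_self_eq_norm_sq]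
    congr 2
    have e4 : ∀ x : Oct, √2 • x = (2 : ℝ) • (√2)⁻¹ • x := fun x => by rw [smul_smul, e3]
    rw [e4, ← two_smul ℝ]
    simp only [map_neg, map_smul]
    module

theorem isMirrorPoint_standard :
    IsMirrorPointWithMultiplication (fkmPolynomial op) standardMirrorPoint op :=
  ⟨basePoint, baseNormal, isMirrorPair_base h, rfl, _, _, _, _, _, _, _, isMirrorFrame_base h⟩

end Forms

/-! ### The intertwining isometry and the conclusion. -/

/-- An intertwining isometry between the Clifford systems of two orthogonal multiplications that
become isomorphic after multiplying the left factor by a unit vector. -/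
theorem exists_isometry_cliff {op op' : Oct →ₗ[ℝ] Oct →ₗ[ℝ] Oct}
    (h : IsNormalizedOrthogonalMultiplication op) {w : Oct} (hw : ‖w‖ = 1)
    (hop : ∀ x y, op (op w x) y = op w (op' x y)) :
    ∃ Φ : Oct4 ≃ₗᵢ[ℝ] Oct4, (∀ z, Φ (cliffNeg z) = cliffNeg (Φ z)) ∧
      ∀ a z, Φ (cliff op a z) = cliff op' a (Φ z) := by
  let β : Oct ≃ₗᵢ[ℝ] Oct := LinearIsometry.toLinearIsometryEquiv
    (⟨op w, fun x => by rw [h.norm_op, hw, one_mul]⟩ : Oct →ₗᵢ[ℝ] Oct) rfl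
  have hβ : ∀ x, β x = op w x := fun _ => rfl
  -- The inverse of left multiplication by w changes only the left factor, so the right factor e_a
  -- or its conjugate stays fixed.
  have hα : ∀ x y, β.symm (op x y) = op' (β.symm x) y := by
    intro x y
    rw [β.symm_apply_eq, hβ, ← hop, ← hβ, β.apply_symm_apply]
  let Φ : Oct4 ≃ₗᵢ[ℝ] Oct4 := LinearIsometryEquiv.piLpCongrRight 2
    ![LinearIsometryEquiv.refl ℝ Oct, LinearIsometryEquiv.refl ℝ Oct, β.symm, β.symm]
  have c0 : ∀ z, Φ z 0 = z 0 := fun _ => rfl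
  have c1 : ∀ z, Φ z 1 = z 1 := fun _ => rfl
  have c2 : ∀ z, Φ z 2 = β.symm (z 2) := fun _ => rfl
  have c3 : ∀ z, Φ z 3 = β.symm (z 3) := fun _ => rfl
  refine ⟨Φ, fun z => ?_, fun a z => ?_⟩
  · rw [Oct4.ext_iff]
    simp only [c0, c1, c2, c3, cliffNeg, Oct4.mk_zero, Oct4.mk_one, Oct4.mk_two, Oct4.mk_three,
      map_neg, and_self]
  · rw [Oct4.ext_iff]
    simp only [c0, c1, c2, c3, cliff, Oct4.mk_zero, Oct4.mk_one, Oct4.mk_two, Oct4.mk_three,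
      map_neg, hα, and_self]

theorem fkmPolynomial_isometry {op op' : Oct →ₗ[ℝ] Oct →ₗ[ℝ] Oct} {Φ : Oct4 ≃ₗᵢ[ℝ] Oct4}
    (h₁ : ∀ z, Φ (cliffNeg z) = cliffNeg (Φ z)) (h₂ : ∀ a z, Φ (cliff op a z) = cliff op' a (Φ z))
    (z : Oct4) : fkmPolynomial op' (Φ z) = fkmPolynomial op z := by
  simp only [fkmPolynomial, ← h₁, ← h₂, LinearIsometryEquiv.norm_map,
    LinearIsometryEquiv.inner_map_map]

end Isoparametric

theorem proposition5p1
    (op : Isoparametric.Oct →ₗ[ℝ] Isoparametric.Oct →ₗ[ℝ] Isoparametric.Oct)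
    (hop : Isoparametric.IsNormalizedOrthogonalMultiplication op) :
    ∃ xstar ∈ Isoparametric.focalMinus (Isoparametric.fkmPolynomial op),
      ∃ op' : Isoparametric.Oct →ₗ[ℝ] Isoparametric.Oct →ₗ[ℝ] Isoparametric.Oct,
        ((∀ a b, op' a b = Isoparametric.octMul a b) ∨
          (∀ a b, op' a b = Isoparametric.octMul b a)) ∧
        Isoparametric.IsMirrorPointWithMultiplication
          (Isoparametric.fkmPolynomial op) xstar op' ∧
        ∃ Φ : Isoparametric.Oct4 ≃ₗᵢ[ℝ] Isoparametric.Oct4,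
          Φ xstar = Isoparametric.standardMirrorPoint ∧
          (∀ z, Φ (Isoparametric.cliffNeg z) = Isoparametric.cliffNeg (Φ z)) ∧
          (∀ a z, Φ (Isoparametric.cliff op a z) = Isoparametric.cliff op' a (Φ z)) := by
  obtain ⟨w, hw, op', hop', hwop⟩ := hop.exists_octonionic_unit
  obtain ⟨Φ, h₁, h₂⟩ := Isoparametric.exists_isometry_cliff hop hw hwop
  have hn : Isoparametric.IsNormalizedOrthogonalMultiplication op' := by
    rcases hop' with h | h
    · obtain rfl : op' = Isoparametric.octMul := LinearMap.ext₂ h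
      exact Isoparametric.octMul_isNormalized
    · obtain rfl : op' = Isoparametric.octMul.flip := LinearMap.ext₂ h
      exact Isoparametric.octMul_isNormalized.flip
  have hF : ∀ z, Isoparametric.fkmPolynomial op (Φ.symm z) = Isoparametric.fkmPolynomial op' z := by
    intro z
    rw [← Isoparametric.fkmPolynomial_isometry h₁ h₂, Φ.apply_symm_apply]
  -- The standard point is a mirror point with multiplication ∘' for the system of ∘'; the inverse
  -- isometry carries it to the system of ∘.
  exact ⟨Φ.symm Isoparametric.standardMirrorPoint,
    (Isoparametric.mem_focalMinus_isometry hF _).2 (Isoparametric.mirrorMinus_mem hn), op', hop',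
    (Isoparametric.isMirrorPoint_standard hn).isometry hF, Φ, Φ.apply_symm_apply _, h₁, h₂⟩
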